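/- Setting. Let $\mathbb K$ be an at most countable index set, $(\mathcal X,\mathfrak A)$ a measurable space, $\mathcal Y\subset\mathbb R$ a nonempty bounded interval, $b=\sup_{y\in\mathcal Y}|y|$, and $P$ a probability measure on $\mathcal X\times\mathcal Y$. Let $(\phi_k)_{k\in\mathbb K}$ be measurable functions $\mathcal X\to\mathbb R$ with $\sum_k|\phi_k(x)|^2\le\kappa^2$ for every $x\in\mathcal X$, where $\kappa>0$; put $\Phi(x)=(\phi_k(x))_k\in\ell^2(\mathbb K)$, $f_u=\sum_k\mu_k\phi_k$ (pointwise) for $u=(\mu_k)_k\in\ell^2(\mathbb K)$, $R(f)=\int|f(x)-y|^2\,dP(x,y)$ and $F(u)=R(f_u)$. Let $r\in(1,2]$, $r^*=r/(r-1)$, $\eta>0$. Write $t_+=\max(t,0)$, $t_-=\max(-t,0)$, and let $\Gamma_0^+(\mathbb R)$ be the set of proper lower semicontinuous convex functions $\mathbb R\to[0,+\infty]$. For every $k\in\mathbb K$ let $C_k\subset\mathbb R$ be a closed interval containing $0$, let $D_k\subset\mathbb R$ be a nonempty closed bounded interval, and let $h_k\in\Gamma_0^+(\mathbb R)$ satisfy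 $h_k(0)=0$ and $h_k-\eta|\cdot|^r\in\Gamma_0^+(\mathbb R)$. Assume $\sum_k((\inf D_k)_+)^{r^*}<+\infty$ and $\sum_k((\sup D_k)_-)^{r^*}<+\infty$. Set $g_k=\iota_{C_k}+\sigma_{D_k}+h_k$, where $\iota_{C_k}$ is the indicator function of $C_k$ ($0$ on $C_k$, $+\infty$ elsewhere) and $\sigma_{D_k}(t)=\sup_{d\in D_k}dt$, and $G(u)=\sum_kg_k(\mu_k)\in(-\infty,+\infty]$ for $u\in\ell^2(\mathbb K)$. The subdifferential of $G$ at $u$ is $\partial G(u)=\{p\in\ell^2(\mathbb K): G(u)+\langle v-u,p\rangle\le G(v)\ \text{for all}\ v\in\ell^2(\mathbb K)\}$. Let $\varepsilon:(0,\infty)\to[0,1]$ satisfy $\varepsilon(\lambda)\to0$ as $\lambda\to0^+$, and let $M=\frac{7}{32}r(r-1)\bigl(1-(2/3)^{r-1}\bigr)$. Theorem. Let $\lambda>0$. Then $F+\lambda G$ has a unique minimizer $u_\lambda$ on $\ell^2(\mathbb K)$, and $u_\lambda\in\ell^r(\mathbb K)$. Put $\Psi_\lambda:\mathcal X\times\mathcal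 Y\to\ell^2(\mathbb K)$, $\Psi_\lambda(x,y)=2(f_{u_\lambda}(x)-y)\Phi(x)$. Then the following hold. (i) $\|\Psi_\lambda(x,y)\|_2\le2\kappa(\kappa\|u_\lambda\|_2+b)$ for all $(x,y)\in\mathcal X\times\mathcal Y$. Moreover $\Psi_\lambda\in L^2(P;\ell^2(\mathbb K))$ with $\bigl(\int\|\Psi_\lambda\|_2^2\,dP\bigr)^{1/2}\le2\kappa\sqrt{R(f_{u_\lambda})}$, and $-\mathsf E_P(\Psi_\lambda)\in\lambda\,\partial G(u_\lambda)$. (ii) Let $n\ge1$, let $(x_i,y_i)_{1\le i\le n}\in(\mathcal X\times\mathcal Y)^n$, and let $\widehat u\in\ell^2(\mathbb K)$ be an $\varepsilon(\lambda)$-minimizer on $\ell^2(\mathbb K)$ of $\widehat J(u)=\frac1n\sum_{i=1}^n|f_u(x_i)-y_i|^2+\lambda G(u)$, that is, $\widehat J(\widehat u)\le\inf\widehat J+\varepsilon(\lambda)$. Then $\widehat u\in\ell^r(\mathbb K)$ and there exists $\widehat v\in\ell^r(\mathbb K)$ such that $\|\widehat v-\widehat u\|_r\le\sqrt{\varepsilon(\lambda)}$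 and $$\frac{\eta M\|\widehat v-u_\lambda\|_r}{(\|u_\lambda\|_r+\|\widehat v-u_\lambda\|_r)^{2-r}}\le\frac1\lambda\Bigl(\Bigl\|\frac1n\sum_{i=1}^n\Psi_\lambda(x_i,y_i)-\mathsf E_P(\Psi_\lambda)\Bigr\|_2+\sqrt{\varepsilon(\lambda)}\Bigr),$$ where the left-hand side is read as $0$ if $\widehat v=u_\lambda=0$. -/

import Mathlib

open MeasureTheory Filter Topology
open scoped ENNReal Pointwise

noncomputable section

namespace RegLearning

/-- The real Hilbert space of square-summable families indexed by `K`. -/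
abbrev L2 (K : Type*) : Type _ := lp (fun _ : K => ℝ) 2

/-- Membership of a real family in the space of `r`-summable families. -/
def MemLr {K : Type*} (r : ℝ) (u : K → ℝ) : Prop := Memℓp u (ENNReal.ofReal r)

/-- The norm `‖u‖_r = (∑ₖ |uₖ|^r)^(1/r)`; it is meaningful for families with `MemLr r u`. -/
def lrNorm {K : Type*} (r : ℝ) (u : K → ℝ) : ℝ := (∑' k, |u k| ^ r) ^ (1 / r)

section ConvexAnalysis

variable {H : Type*} [NormedAddCommGroup H] [InnerProductSpace ℝ H]

/-- The class `Γ₀(H)` of proper lower semicontinuous convex functions from `H` to `]-∞, +∞]`. -/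
structure IsGammaZero (f : H → EReal) : Prop where
  ne_bot : ∀ x, f x ≠ ⊥
  proper : ∃ x, f x ≠ ⊤
  lsc : LowerSemicontinuous f
  convex : ∀ x y : H, ∀ s t : ℝ, 0 < s → 0 < t → s + t = 1 →
    f (s • x + t • y) ≤ (s : EReal) * f x + (t : EReal) * f y

/-- The class `Γ₀⁺(H)` of functions in `Γ₀(H)` with values in `[0, +∞]`. -/
structure IsGammaZeroPlus (f : H → EReal) : Prop extends IsGammaZero f where
  nonneg : ∀ x, 0 ≤ f x

/-- The subdifferential of `f` at `u`. -/
def subdifferential (f : H → EReal) (u : H) : Set H :=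
  {p | ∀ v, f u + ((inner ℝ (v - u) p : ℝ) : EReal) ≤ f v}

/-- The set of `ε`-minimizers of `f`. -/
def argminEps (f : H → EReal) (ε : ℝ) : Set H :=
  {u | f u ≤ (⨅ v, f v) + (ε : EReal)}

end ConvexAnalysis

/-- The indicator function of `C`: zero on `C`, `+∞` outside. -/
def indicatorFn (C : Set ℝ) (t : ℝ) : EReal :=
  open Classical in if t ∈ C then 0 else ⊤

/-- The support function of `D`. -/
def supportFn (D : Set ℝ) (t : ℝ) : EReal := ⨆ v ∈ D, ((v * t : ℝ) : EReal)

/-- The sum of a family of extended reals: the sum of the positive parts minus the sum of the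
negative parts. It is used only for families whose negative parts have a finite sum. -/
def extSum {K : Type*} (a : K → EReal) : EReal :=
  ((∑' k, (a k).toENNReal : ℝ≥0∞) : EReal) - ((∑' k, (-a k).toENNReal : ℝ≥0∞) : EReal)

/-- The data of the learning problem together with the standing assumptions on them. -/
structure Setting (X K : Type*) [MeasurableSpace X] where
  /-- the output set, a nonempty bounded interval -/
  Y : Set ℝ
  Y_nonempty : Y.Nonempty
  Y_interval : Y.OrdConnected
  Y_bounded : Bornology.IsBounded Y
  /-- the distribution of an input/output pair -/
  P : Measure (X × Y)
  P_prob : IsProbabilityMeasure P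
  /-- the dictionary -/
  φ : K → X → ℝ
  φ_meas : ∀ k, Measurable (φ k)
  κ : ℝ
  κ_pos : 0 < κ
  φ_summable : ∀ x, Summable fun k => |φ k x| ^ 2
  φ_bound : ∀ x, ∑' k, |φ k x| ^ 2 ≤ κ ^ 2
  r : ℝ
  one_lt_r : 1 < r
  r_le_two : r ≤ 2
  η : ℝ
  η_pos : 0 < η
  /-- the constraint intervals -/
  C : K → Set ℝ
  C_interval : ∀ k, (C k).OrdConnected
  C_closed : ∀ k, IsClosed (C k)
  zero_mem_C : ∀ k, (0 : ℝ) ∈ C k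
  /-- the thresholding intervals -/
  D : K → Set ℝ
  D_nonempty : ∀ k, (D k).Nonempty
  D_interval : ∀ k, (D k).OrdConnected
  D_closed : ∀ k, IsClosed (D k)
  D_bounded : ∀ k, Bornology.IsBounded (D k)
  /-- the positive parts of `inf Dₖ` are summable to the conjugate power `r* = r / (r - 1)` -/
  D_inf : Summable fun k => (max (sInf (D k)) 0) ^ (r / (r - 1))
  /-- the negative parts of `sup Dₖ` are summable to the conjugate power `r* = r / (r - 1)` -/
  D_sup : Summable fun k => (max (-sSup (D k)) 0) ^ (r / (r - 1))
  h : K → ℝ → EReal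
  h_gamma : ∀ k, IsGammaZeroPlus (h k)
  h_zero : ∀ k, h k 0 = 0
  h_sub_gamma : ∀ k, IsGammaZeroPlus fun t => h k t - ((η * |t| ^ r : ℝ) : EReal)

namespace Setting

variable {X K : Type*} [MeasurableSpace X] (S : Setting X K)

/-- `b = sup_{y ∈ Y} |y|`. -/
def b : ℝ := sSup ((fun y : ℝ => |y|) '' S.Y)

theorem memℓp_feature (x : X) : Memℓp (fun k => S.φ k x) 2 := by
  refine memℓp_gen ?_
  simpa using S.φ_summable x

/-- The feature map `Φ(x) = (φₖ(x))ₖ`. -/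
def featureMap (x : X) : L2 K := ⟨fun k => S.φ k x, S.memℓp_feature x⟩

/-- The function `f_u = ∑ₖ uₖ φₖ` (pointwise). -/
def f (u : L2 K) (x : X) : ℝ := ∑' k, u k * S.φ k x

/-- The risk `R`. -/
def risk (g : X → ℝ) : ℝ := ∫ z, |g z.1 - (z.2 : ℝ)| ^ 2 ∂S.P

/-- `F(u) = R(f_u)`. -/
def F (u : L2 K) : ℝ := S.risk (S.f u)

/-- `gₖ = ι_{Cₖ} + σ_{Dₖ} + hₖ`. -/
def g (k : K) (t : ℝ) : EReal := indicatorFn (S.C k) t + supportFn (S.D k) t + S.h k t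

/-- `G(u) = ∑ₖ gₖ(uₖ)`. -/
def G (u : L2 K) : EReal := extSum fun k => S.g k (u k)

/-- The regularized risk `F + lam G`. -/
def regRisk (lam : ℝ) (u : L2 K) : EReal := (S.F u : EReal) + (lam : EReal) * S.G u

/-- The regularized empirical risk for the training set `z`. -/
def empRisk (lam : ℝ) {n : ℕ} (z : Fin n → X × S.Y) (u : L2 K) : EReal :=
  ((1 / (n : ℝ) * ∑ i, |S.f u (z i).1 - ((z i).2 : ℝ)| ^ 2 : ℝ) : EReal) + (lam : EReal) * S.G u

/-- `(x, y) ↦ 2 (f_u(x) - y) Φ(x)`. -/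
def Psi (u : L2 K) (z : X × S.Y) : L2 K :=
  (2 * (S.f u z.1 - (z.2 : ℝ))) • S.featureMap z.1

/-- `M = (7/32) r (r - 1) (1 - (2/3)^(r-1))`. -/
def M : ℝ := 7 / 32 * S.r * (S.r - 1) * (1 - (2 / 3 : ℝ) ^ (S.r - 1))

end Setting

end RegLearning

end

noncomputable section
namespace RegLearning

/-! ### Strong convexity of the scalar power on bounded intervals. -/

section Scalar

/-! Each `g k` is a convex function plus `η|·|^r`, and since `r ≤ 2` the power `|·|^r` is strongly
convex on `[-m, m]` with a constant proportional to `m ^ (r - 2)` (`strongConvex_abs_rpow`). Summed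
over coordinates, this gives the regularizer a convexity gain equal to a weighted quadratic sum
`gap`, and Hölder's inequality turns it into `‖v - u‖_r ^ 2 ≤ gap * ‖m‖_r ^ (2 - r)`
(`lrENorm_sq_le`). The denominator in the final estimate comes from this factor.

The support functions may be negative. Young's inequality bounds their negative part by half of
`η|t|^r` plus an offset that is summable by the assumptions on `D`. Hence `G = W - const` with `W`
valued in `[0, ∞]`, lower semicontinuous, and controlling the `ℓ^r` norm. The true and the empirical
risk are exact convex quadratics (`IsQuadratic`). Near-minimizers of risk plus `lam W` are therefore
close to each other, so minimizing sequences are Cauchy: this yields existence and uniqueness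
without weak compactness. Comparing the minimizer with points of a segment and letting the step tend
to zero gives `first_order`, hence the subdifferential inclusion.

For part (ii), adding `√ε ‖· - uhat‖_r` to the empirical objective keeps it convex and coercive, so
it has a minimizer `v`, which has the properties given by Ekeland's principle
(`exists_perturbed_minimizer`). Adding the first-order inequalities at `uL` and at `v` cancels the
regularizer, and monotonicity of the empirical gradient leaves only the difference of the two
gradients at `uL` (`stability`). -/

theorem hasDerivAt_rpow_sub_sq {r c s : ℝ} (hs : 0 < s) :
    HasDerivAt (fun s : ℝ => s ^ r - c * s ^ 2) (r * s ^ (r - 1) - 2 * c * s) s := by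
  have h1 := Real.hasDerivAt_rpow_const (x := s) (p := r) (Or.inl hs.ne')
  have h2 := ((hasDerivAt_id s).pow 2).const_mul c
  refine (h1.sub h2).congr_deriv ?_
  simp
  ring

/-- The second derivative is `r (r - 1) (s ^ (r - 2) - m ^ (r - 2))`, nonnegative for `0 < s < m`
because `r - 2 ≤ 0`; the constant is the largest with this property. -/
theorem convexOn_rpow_sub_sq {r m : ℝ} (hr : 1 < r) (hr2 : r ≤ 2) :
    ConvexOn ℝ (Set.Icc 0 m) fun s : ℝ => s ^ r - r * (r - 1) / 2 * m ^ (r - 2) * s ^ 2 := by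
  set c := r * (r - 1) / 2 * m ^ (r - 2) with hc
  refine convexOn_of_hasDerivWithinAt2_nonneg (convex_Icc 0 m)
    (f' := fun s => r * s ^ (r - 1) - 2 * c * s)
    (f'' := fun s => r * ((r - 1) * s ^ (r - 1 - 1)) - 2 * c) ?_ ?_ ?_ ?_
  · exact ((Real.continuous_rpow_const (by linarith)).sub (by fun_prop)).continuousOn
  · intro s hs
    rw [interior_Icc] at hs
    exact (hasDerivAt_rpow_sub_sq hs.1).hasDerivWithinAt
  · intro s hs
    rw [interior_Icc] at hs
    have h1 := (Real.hasDerivAt_rpow_const (x := s) (p := r - 1) (Or.inl hs.1.ne')).const_mul r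
    have h2 := (hasDerivAt_id s).const_mul (2 * c)
    refine ((h1.sub h2).congr_deriv ?_).hasDerivWithinAt
    simp
  · intro s hs
    rw [interior_Icc] at hs
    have h : m ^ (r - 2) ≤ s ^ (r - 2) :=
      Real.rpow_le_rpow_of_nonpos hs.1 hs.2.le (by linarith)
    have h0 : 0 ≤ r * (r - 1) := by nlinarith
    have h3 : r - 1 - 1 = r - 2 := by ring
    simp only [h3, hc]
    nlinarith [mul_le_mul_of_nonneg_left h h0]

/-- Monotonicity is what lets convexity on `[0, m]` survive composition with `|·|`. The derivative
is `r s (s ^ (r - 2) - (r - 1) m ^ (r - 2))`, and `r - 1 ≤ 1`. -/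
theorem monotoneOn_rpow_sub_sq {r m : ℝ} (hr : 1 < r) (hr2 : r ≤ 2) :
    MonotoneOn (fun s : ℝ => s ^ r - r * (r - 1) / 2 * m ^ (r - 2) * s ^ 2) (Set.Icc 0 m) := by
  refine monotoneOn_of_hasDerivWithinAt_nonneg (convex_Icc 0 m)
    (f' := fun s => r * s ^ (r - 1) - 2 * (r * (r - 1) / 2 * m ^ (r - 2)) * s) ?_ ?_ ?_
  · exact ((Real.continuous_rpow_const (by linarith)).sub (by fun_prop)).continuousOn
  · intro s hs
    rw [interior_Icc] at hs
    exact (hasDerivAt_rpow_sub_sq hs.1).hasDerivWithinAt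
  · intro s hs
    rw [interior_Icc] at hs
    have h : m ^ (r - 2) ≤ s ^ (r - 2) :=
      Real.rpow_le_rpow_of_nonpos hs.1 hs.2.le (by linarith)
    have hm : 0 < m ^ (r - 2) := Real.rpow_pos_of_pos (hs.1.trans hs.2) _
    have h1 : s ^ (r - 1) = s ^ (r - 2) * s := by
      rw [← Real.rpow_add_one hs.1.ne']
      ring_nf
    have h2 : (r - 1) * m ^ (r - 2) ≤ s ^ (r - 2) := by nlinarith
    have h3 : 0 ≤ r * s := mul_nonneg (by linarith) hs.1.le
    rw [h1]
    nlinarith [mul_le_mul_of_nonneg_left h2 h3]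

/-- Strong convexity of `|·|^r` on `[-m, m]`. -/
theorem strongConvex_abs_rpow {r m a b t : ℝ} (hr : 1 < r) (hr2 : r ≤ 2) (ha : |a| ≤ m)
    (hb : |b| ≤ m) (ht0 : 0 ≤ t) (ht1 : t ≤ 1) :
    |(1 - t) * a + t * b| ^ r + r * (r - 1) / 2 * (t * (1 - t)) * ((b - a) ^ 2 * m ^ (r - 2))
      ≤ (1 - t) * |a| ^ r + t * |b| ^ r := by
  have himg : ((fun s : ℝ => |s|) '' Set.Icc (-m) m) ⊆ Set.Icc 0 m := by
    rintro _ ⟨s, hs, rfl⟩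
    exact ⟨abs_nonneg s, abs_le.2 hs⟩
  have habs : ConvexOn ℝ (Set.Icc (-m) m) fun s : ℝ => |s| :=
    ⟨convex_Icc _ _, fun x _ y _ p q hp hq _ => by
      simpa [abs_mul, abs_of_nonneg hp, abs_of_nonneg hq] using abs_add_le (p * x) (q * y)⟩
  have himgc : Convex ℝ ((fun s : ℝ => |s|) '' Set.Icc (-m) m) := by
    refine (isPreconnected_Icc.image _ continuous_abs.continuousOn).ordConnected.convex
  have hconv := (((convexOn_rpow_sub_sq (m := m) hr hr2).subset himg himgc).comp habs
    ((monotoneOn_rpow_sub_sq hr hr2).mono himg)).2 (abs_le.1 ha) (abs_le.1 hb)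
    (by linarith : 0 ≤ 1 - t) ht0 (by ring)
  simp only [Function.comp, smul_eq_mul, sq_abs] at hconv
  -- The subtracted squares produce the gain through `(1 - t) a² + t b² - ((1 - t) a + t b)² = t (1
  -- - t) (b - a)²`.
  nlinarith [hconv]

end Scalar

/-! ### The `ℓ^r` norm with values in `[0, ∞]`. -/

section LrNorm

variable {K : Type*}

/-- The `ℓ^r` norm with values in `[0, ∞]`. -/
def lrENorm (r : ℝ) (u : K → ℝ) : ℝ≥0∞ := (∑' k, ‖u k‖ₑ ^ r) ^ (1 / r)

theorem lrENorm_rpow {r : ℝ} (hr : 0 < r) (u : K → ℝ) :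
    lrENorm r u ^ r = ∑' k, ‖u k‖ₑ ^ r := by
  rw [lrENorm, ← ENNReal.rpow_mul, one_div, inv_mul_cancel₀ hr.ne', ENNReal.rpow_one]

theorem tsum_rpow_mul_rpow_le (f g : K → ℝ≥0∞) {p q : ℝ} (hp : 0 ≤ p) (hq : 0 ≤ q)
    (hpq : p + q = 1) :
    ∑' k, f k ^ p * g k ^ q ≤ (∑' k, f k) ^ p * (∑' k, g k) ^ q := by
  let _ : MeasurableSpace K := ⊤
  simpa only [lintegral_count] using ENNReal.lintegral_mul_norm_pow_le (μ := Measure.count)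
    (f := f) (g := g) measurable_from_top.aemeasurable measurable_from_top.aemeasurable hp hq hpq

theorem lrENorm_add_le {r : ℝ} (hr : 1 ≤ r) (u v : K → ℝ) :
    lrENorm r (u + v) ≤ lrENorm r u + lrENorm r v := by
  let _ : MeasurableSpace K := ⊤
  have h := ENNReal.lintegral_Lp_add_le (μ := Measure.count) (p := r) (f := fun k => ‖u k‖ₑ)
    (g := fun k => ‖v k‖ₑ) measurable_from_top.aemeasurable measurable_from_top.aemeasurable hr
  simp only [lintegral_count] at h
  refine le_trans ?_ h
  unfold lrENorm
  gcongr with k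
  exact enorm_add_le _ _

theorem lrENorm_abs (r : ℝ) (u : K → ℝ) : lrENorm r (fun k => |u k|) = lrENorm r u := by
  simp [lrENorm]

theorem lrENorm_neg (r : ℝ) (u : K → ℝ) : lrENorm r (-u) = lrENorm r u := by
  simp [lrENorm]

theorem lrENorm_sub_comm (r : ℝ) (u v : K → ℝ) : lrENorm r (u - v) = lrENorm r (v - u) := by
  rw [← lrENorm_neg, neg_sub]

theorem lrENorm_sub_self {r : ℝ} (hr : 0 < r) (u : L2 K) : lrENorm r ⇑(u - u) = 0 := by
  simp [lrENorm, hr]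

theorem lrENorm_smul {r : ℝ} (hr : 0 < r) (c : ℝ) (u : K → ℝ) :
    lrENorm r (c • u) = ‖c‖ₑ * lrENorm r u := by
  simp only [lrENorm, Pi.smul_apply, smul_eq_mul, enorm_mul,
    ENNReal.mul_rpow_of_nonneg _ _ hr.le, ENNReal.tsum_mul_left]
  rw [ENNReal.mul_rpow_of_nonneg _ _ (by positivity), ← ENNReal.rpow_mul, one_div,
    mul_inv_cancel₀ hr.ne', ENNReal.rpow_one]

/-- A weighted reverse Hölder inequality: the weighted quadratic sum controls the `ℓ^r` norm. -/
theorem lrENorm_sq_le {r : ℝ} (hr : 0 < r) (hr2 : r ≤ 2) {d m : K → ℝ} (hm : ∀ k, 0 ≤ m k)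
    (hd : ∀ k, m k = 0 → d k = 0) :
    lrENorm r d ^ 2 ≤ (∑' k, ENNReal.ofReal (d k ^ 2 * m k ^ (r - 2))) *
      lrENorm r m ^ (2 - r) := by
  set S := ∑' k, ENNReal.ofReal (d k ^ 2 * m k ^ (r - 2)) with hS
  -- The powers of `m k` on the right cancel, and the outer exponents `r / 2` and `(2 - r) / 2` add
  -- up to `1`, as Hölder requires.
  have hterm : ∀ k, ‖d k‖ₑ ^ r =
      ENNReal.ofReal (d k ^ 2 * m k ^ (r - 2)) ^ (r / 2) * (‖m k‖ₑ ^ r) ^ ((2 - r) / 2) := by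
    intro k
    rcases (hm k).eq_or_lt with h | h
    · have h0 := hd k h.symm
      simp [h0, hr]
    · rw [Real.enorm_eq_ofReal_abs, Real.enorm_eq_ofReal (hm k),
        ENNReal.ofReal_rpow_of_nonneg (by positivity) (by positivity),
        ENNReal.ofReal_rpow_of_nonneg (by positivity) (by positivity),
        ENNReal.ofReal_rpow_of_nonneg (by positivity) (by linarith),
        ENNReal.ofReal_rpow_of_nonneg (by positivity) (by linarith),
        ← ENNReal.ofReal_mul (by positivity)]
      congr 1
      rw [Real.mul_rpow (by positivity) (by positivity), ← sq_abs, ← Real.rpow_natCast,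
        ← Real.rpow_mul (abs_nonneg _), ← Real.rpow_mul h.le, ← Real.rpow_mul h.le, mul_assoc,
        ← Real.rpow_add h]
      have e1 : ((2 : ℕ) : ℝ) * (r / 2) = r := by push_cast; ring
      have e2 : (r - 2) * (r / 2) + r * ((2 - r) / 2) = 0 := by ring
      rw [e1, e2, Real.rpow_zero, mul_one]
  have hsum : lrENorm r d ^ r ≤ S ^ (r / 2) * (lrENorm r m ^ r) ^ ((2 - r) / 2) := by
    rw [lrENorm_rpow hr, lrENorm_rpow hr]
    simp only [hterm]
    exact tsum_rpow_mul_rpow_le _ _ (by positivity) (by linarith) (by ring)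
  have h2 := ENNReal.rpow_le_rpow hsum (by positivity : 0 ≤ 2 / r)
  rw [ENNReal.mul_rpow_of_nonneg _ _ (by positivity), ← ENNReal.rpow_mul, ← ENNReal.rpow_mul,
    ← ENNReal.rpow_mul, ← ENNReal.rpow_mul] at h2
  have e1 : r * (2 / r) = (2 : ℕ) := by push_cast; field_simp
  have e2 : r / 2 * (2 / r) = 1 := by field_simp
  have e3 : r * ((2 - r) / 2 * (2 / r)) = 2 - r := by field_simp
  rwa [e1, e2, e3, ENNReal.rpow_one, ENNReal.rpow_natCast] at h2

theorem enorm_le_lrENorm_apply {r : ℝ} (hr : 0 < r) (u : K → ℝ) (k : K) :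
    ‖u k‖ₑ ≤ lrENorm r u := by
  have h : ‖u k‖ₑ ^ r ≤ lrENorm r u ^ r := by
    rw [lrENorm_rpow hr]
    exact ENNReal.le_tsum k
  exact (ENNReal.rpow_le_rpow_iff hr).1 h

/-- With `N` the `ℓ^r` norm, every coordinate is at most `N`, so `∑ |u k|² ≤ N ^ (2 - r) * ∑ |u k| ^
r = N²`. -/
theorem enorm_le_lrENorm {r : ℝ} (hr : 0 < r) (hr2 : r ≤ 2) (u : L2 K) :
    ‖u‖ₑ ≤ lrENorm r u := by
  have h2 : ‖u‖ₑ ^ 2 = ∑' k, ‖u k‖ₑ ^ 2 := by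
    have h := lp.hasSum_norm (p := 2) (by norm_num) u
    simp only [ENNReal.toReal_ofNat, Real.rpow_ofNat] at h
    rw [← ofReal_norm, ← ENNReal.ofReal_pow (norm_nonneg _), ← h.tsum_eq,
      ENNReal.ofReal_tsum_of_nonneg (fun k => by positivity) h.summable]
    refine tsum_congr fun k => ?_
    rw [← ofReal_norm, ENNReal.ofReal_pow (norm_nonneg _)]
  have hle : ‖u‖ₑ ^ 2 ≤ lrENorm r u ^ 2 := by
    have hsplit : ∀ x : ℝ≥0∞, x ^ 2 = x ^ (2 - r) * x ^ r := fun x => by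
      rw [← ENNReal.rpow_add_of_nonneg _ _ (by linarith) hr.le, sub_add_cancel,
        ENNReal.rpow_ofNat]
    rw [h2, hsplit (lrENorm r u), lrENorm_rpow hr, ← ENNReal.tsum_mul_left]
    refine ENNReal.tsum_le_tsum fun k => ?_
    rw [hsplit]
    gcongr
    exact enorm_le_lrENorm_apply hr _ k
  exact (ENNReal.pow_le_pow_left_iff two_ne_zero).1 hle

theorem continuous_coord (k : K) : Continuous fun u : L2 K => u k :=
  (continuous_apply k).comp (lp.uniformContinuous_coe (p := 2)).continuous

theorem lowerSemicontinuous_lrENorm {r : ℝ} (hr : 0 < r) :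
    LowerSemicontinuous fun u : L2 K => lrENorm r u := by
  have h : LowerSemicontinuous fun u : L2 K => ∑' k, ‖u k‖ₑ ^ r :=
    lowerSemicontinuous_tsum fun k => Continuous.lowerSemicontinuous <|
      (ENNReal.continuous_rpow_const).comp ((continuous_coord k).enorm)
  exact (ENNReal.continuous_rpow_const (y := 1 / r)).comp_lowerSemicontinuous h
    (ENNReal.monotone_rpow_of_nonneg (by positivity))

theorem memLr_iff {r : ℝ} (hr : 0 < r) (u : K → ℝ) : MemLr r u ↔ lrENorm r u ≠ ⊤ := by
  have h1 : lrENorm r u ≠ ⊤ ↔ (∑' k, ENNReal.ofReal (|u k| ^ r)) ≠ ⊤ := by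
    have e : ∀ k, ‖u k‖ₑ ^ r = ENNReal.ofReal (|u k| ^ r) := fun k => by
      rw [Real.enorm_eq_ofReal_abs, ENNReal.ofReal_rpow_of_nonneg (abs_nonneg _) hr.le]
    simp only [lrENorm, e, ne_eq, ENNReal.rpow_eq_top_iff_of_pos (one_div_pos.2 hr)]
  rw [MemLr, memℓp_gen_iff (by rwa [ENNReal.toReal_ofReal hr.le]), h1,
    ENNReal.toReal_ofReal hr.le]
  simp only [Real.norm_eq_abs]
  refine ⟨fun h => h.tsum_ofReal_ne_top, fun h => ?_⟩
  have := ENNReal.summable_toReal h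
  refine this.congr fun k => ?_
  rw [ENNReal.toReal_ofReal (by positivity)]

theorem lrNorm_eq {r : ℝ} (hr : 0 < r) (u : K → ℝ) : lrNorm r u = (lrENorm r u).toReal := by
  have e : ∀ k, ‖u k‖ₑ ^ r = ENNReal.ofReal (|u k| ^ r) := fun k => by
    rw [Real.enorm_eq_ofReal_abs, ENNReal.ofReal_rpow_of_nonneg (abs_nonneg _) hr.le]
  rw [lrNorm, lrENorm, ← ENNReal.toReal_rpow]
  congr 1
  simp only [e]
  rw [ENNReal.tsum_toReal_eq (fun k => ENNReal.ofReal_ne_top)]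
  exact tsum_congr fun k => (ENNReal.toReal_ofReal (by positivity)).symm

end LrNorm


/-! ### Extended-real convex functions and sums of extended reals. -/

section ExtendedConvex

/-- Convexity of an extended-real function on the line that never takes the value `-∞`. -/
structure IsConvexEReal (f : ℝ → EReal) : Prop where
  ne_bot : ∀ x, f x ≠ ⊥
  convex : ∀ x y : ℝ, ∀ s t : ℝ, 0 < s → 0 < t → s + t = 1 →
    f (s • x + t • y) ≤ (s : EReal) * f x + (t : EReal) * f y

theorem IsConvexEReal.add {f g : ℝ → EReal} (hf : IsConvexEReal f) (hg : IsConvexEReal g) :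
    IsConvexEReal fun x => f x + g x where
  ne_bot x := by simp [EReal.add_eq_bot_iff, hf.ne_bot x, hg.ne_bot x]
  convex x y s t hs ht hst := by
    refine (add_le_add (hf.convex x y s t hs ht hst) (hg.convex x y s t hs ht hst)).trans_eq ?_
    rw [EReal.left_distrib_of_nonneg_of_ne_top (EReal.coe_nonneg.2 hs.le) (EReal.coe_ne_top s),
      EReal.left_distrib_of_nonneg_of_ne_top (EReal.coe_nonneg.2 ht.le) (EReal.coe_ne_top t),
      add_add_add_comm]

theorem isConvexEReal_indicatorFn {C : Set ℝ} (hC : C.OrdConnected) :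
    IsConvexEReal (indicatorFn C) where
  ne_bot x := by
    unfold indicatorFn
    split_ifs <;> simp
  convex x y s t hs ht hst := by
    by_cases hx : x ∈ C
    · by_cases hy : y ∈ C
      · have h := hC.convex hx hy hs.le ht.le hst
        simp only [indicatorFn, hx, hy, h, if_true, mul_zero, add_zero, le_refl]
      · have h : (s : EReal) * indicatorFn C x + (t : EReal) * indicatorFn C y = ⊤ := by
          simp [indicatorFn, hx, hy, EReal.coe_mul_top_of_pos ht]
        rw [h]
        exact le_top
    · have h : (s : EReal) * indicatorFn C x + (t : EReal) * indicatorFn C y = ⊤ := by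
        have hy : (t : EReal) * indicatorFn C y ≠ ⊥ := by
          unfold indicatorFn
          split_ifs <;> simp [EReal.coe_mul_top_of_pos ht]
        simp only [indicatorFn, hx, if_false, EReal.coe_mul_top_of_pos hs] at hy ⊢
        exact EReal.top_add_of_ne_bot hy
      rw [h]
      exact le_top

theorem le_supportFn {D : Set ℝ} {v : ℝ} (hv : v ∈ D) (t : ℝ) :
    ((v * t : ℝ) : EReal) ≤ supportFn D t :=
  le_iSup₂_of_le v hv le_rfl

theorem isConvexEReal_supportFn {D : Set ℝ} (hD : D.Nonempty) :
    IsConvexEReal (supportFn D) where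
  ne_bot x := by
    obtain ⟨v, hv⟩ := hD
    exact ne_bot_of_le_ne_bot (EReal.coe_ne_bot _) (le_supportFn hv x)
  convex x y s t hs ht hst := by
    refine iSup₂_le fun v hv => ?_
    have h : ((v * (s • x + t • y) : ℝ) : EReal)
        = (s : EReal) * ((v * x : ℝ) : EReal) + (t : EReal) * ((v * y : ℝ) : EReal) := by
      norm_cast
      simp only [smul_eq_mul]
      ring
    rw [h]
    exact add_le_add
      (mul_le_mul_of_nonneg_left (le_supportFn hv x) (EReal.coe_nonneg.2 hs.le))
      (mul_le_mul_of_nonneg_left (le_supportFn hv y) (EReal.coe_nonneg.2 ht.le))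

theorem lowerSemicontinuous_indicatorFn {C : Set ℝ} (hC : IsClosed C) :
    LowerSemicontinuous (indicatorFn C) := by
  intro x y hy
  by_cases hx : x ∈ C
  · have h0 : y < 0 := by simpa [indicatorFn, hx] using hy
    refine Eventually.of_forall fun z => ?_
    change y < indicatorFn C z
    unfold indicatorFn
    split_ifs
    · exact h0
    · exact h0.trans EReal.zero_lt_top
  · filter_upwards [hC.isOpen_compl.mem_nhds hx] with z hz
    have hz' : z ∉ C := hz
    simpa [indicatorFn, hx, hz'] using hy

theorem lowerSemicontinuous_supportFn (D : Set ℝ) : LowerSemicontinuous (supportFn D) :=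
  lowerSemicontinuous_biSup fun _ _ => Continuous.lowerSemicontinuous <|
    continuous_coe_real_ereal.comp (continuous_const.mul continuous_id)

theorem lowerSemicontinuous_ereal_add {α : Type*} [TopologicalSpace α] {f g : α → EReal}
    (hf : LowerSemicontinuous f) (hg : LowerSemicontinuous g) (hf' : ∀ x, f x ≠ ⊥)
    (hg' : ∀ x, g x ≠ ⊥) : LowerSemicontinuous fun x => f x + g x :=
  hf.add' hg fun x => EReal.continuousAt_add (Or.inr (hg' x)) (Or.inl (hf' x))

/-- Test the supremum at the endpoint `sSup D` for `t ≥ 0` and at `sInf D` for `t ≤ 0`. The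
coefficient of `|t|` is the distance from `0` to `D` when `D` is an interval. -/
theorem supportFn_lower_bound {D : Set ℝ} (hne : D.Nonempty) (hcl : IsClosed D)
    (hbd : Bornology.IsBounded D) (t : ℝ) :
    ((-(max (max (sInf D) 0) (max (-sSup D) 0) * |t|) : ℝ) : EReal) ≤ supportFn D t := by
  rcases le_total 0 t with ht | ht
  · refine le_trans ?_ (le_supportFn (hcl.csSup_mem hne hbd.bddAbove) t)
    rw [EReal.coe_le_coe_iff, abs_of_nonneg ht]
    have : -sSup D ≤ max (max (sInf D) 0) (max (-sSup D) 0) :=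
      (le_max_left _ _).trans (le_max_right _ _)
    nlinarith
  · refine le_trans ?_ (le_supportFn (hcl.csInf_mem hne hbd.bddBelow) t)
    rw [EReal.coe_le_coe_iff, abs_of_nonpos ht]
    have : sInf D ≤ max (max (sInf D) 0) (max (-sSup D) 0) :=
      (le_max_left _ _).trans (le_max_left _ _)
    nlinarith

/-- Adding a finite offset to each member of a family changes `extSum` by the sum of offsets. -/
theorem extSum_eq_sub {K : Type*} {a : K → EReal} {c : K → ℝ} (hc : ∀ k, 0 ≤ c k)
    (hcs : Summable c) (ha : ∀ k, 0 ≤ a k + (c k : EReal)) :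
    extSum a = ((∑' k, (a k + (c k : EReal)).toENNReal : ℝ≥0∞) : EReal) -
      ((∑' k, c k : ℝ) : EReal) := by
  -- The identity `(a + c)⁺ + a⁻ = a⁺ + c` is free of subtraction, so it can be summed in `[0, ∞]`
  -- and remains valid at `a k = ⊤`.
  have hterm : ∀ k, (a k + (c k : EReal)).toENNReal + (-a k).toENNReal =
      (a k).toENNReal + ENNReal.ofReal (c k) := by
    intro k
    have hk := ha k
    induction h : a k with
    | bot => simp [h] at hk
    | top => simp
    | coe x =>
      rw [h] at hk
      have hx : 0 ≤ x + c k := by exact_mod_cast hk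
      rw [← EReal.coe_add, ← EReal.coe_neg]
      simp only [EReal.toENNReal_of_ne_top (EReal.coe_ne_top _), EReal.toReal_coe]
      rcases le_total 0 x with h0 | h0
      · rw [ENNReal.ofReal_of_nonpos (by linarith : -x ≤ 0), add_zero,
          ENNReal.ofReal_add h0 (hc k)]
      · rw [ENNReal.ofReal_of_nonpos h0, zero_add, ← ENNReal.ofReal_add hx (by linarith)]
        ring_nf
  have hN : ∀ k, (-a k).toENNReal ≤ ENNReal.ofReal (c k) := by
    intro k
    have hk := ha k
    induction h : a k with
    | bot => simp [h] at hk
    | top => simp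
    | coe x =>
      rw [h] at hk
      have hx : 0 ≤ x + c k := by exact_mod_cast hk
      rw [← EReal.coe_neg]
      simp only [EReal.toENNReal_of_ne_top (EReal.coe_ne_top _), EReal.toReal_coe]
      exact ENNReal.ofReal_le_ofReal (by linarith)
  have hC : ∑' k, ENNReal.ofReal (c k) = ENNReal.ofReal (∑' k, c k) :=
    (ENNReal.ofReal_tsum_of_nonneg hc hcs).symm
  have hsum : (∑' k, (a k + (c k : EReal)).toENNReal) + ∑' k, (-a k).toENNReal =
      (∑' k, (a k).toENNReal) + ENNReal.ofReal (∑' k, c k) := by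
    rw [← hC, ← ENNReal.tsum_add, ← ENNReal.tsum_add]
    exact tsum_congr hterm
  have hNtop : ∑' k, (-a k).toENNReal ≠ ⊤ :=
    ne_top_of_le_ne_top (by rw [hC]; exact ENNReal.ofReal_ne_top) (ENNReal.tsum_le_tsum hN)
  rw [extSum]
  generalize (∑' k, (a k + (c k : EReal)).toENNReal) = W at *
  generalize (∑' k, (-a k).toENNReal) = N at *
  generalize (∑' k, (a k).toENNReal) = A at *
  have hC0 : 0 ≤ ∑' k, c k := tsum_nonneg hc
  generalize (∑' k, c k) = C at *
  lift N to NNReal using hNtop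
  induction W with
  | top =>
    have hA : A = ⊤ := by
      by_contra h
      lift A to NNReal using h
      simp at hsum
      exact absurd hsum.symm (ENNReal.add_ne_top.2 ⟨ENNReal.coe_ne_top, ENNReal.ofReal_ne_top⟩)
    rw [hA]
    simp only [EReal.coe_ennreal_top]
    rw [EReal.top_sub_coe]
    exact EReal.top_sub_coe _
  | coe W =>
    have hA : A ≠ ⊤ := by
      rintro rfl
      simp at hsum
    lift A to NNReal using hA
    have h := congrArg ENNReal.toReal hsum
    rw [ENNReal.toReal_add ENNReal.coe_ne_top ENNReal.coe_ne_top,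
      ENNReal.toReal_add ENNReal.coe_ne_top ENNReal.ofReal_ne_top, ENNReal.toReal_ofReal hC0] at h
    simp only [ENNReal.coe_toReal] at h
    have e : ∀ x : NNReal, (((x : ℝ≥0∞)) : EReal) = ((x : ℝ) : EReal) := fun x => rfl
    rw [e, e, e, ← EReal.coe_sub, ← EReal.coe_sub]
    congr 1
    linarith

end ExtendedConvex

/-! ### The regularizer as a nonnegative strongly convex function minus a constant. -/

namespace Setting

variable {X K : Type*} [MeasurableSpace X] (S : Setting X K)

/-- The part of `gₖ` that remains convex once `η|·|^r` is removed. -/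
def q (k : K) (t : ℝ) : EReal :=
  indicatorFn (S.C k) t + supportFn (S.D k) t + (S.h k t - ((S.η * |t| ^ S.r : ℝ) : EReal))

theorem g_eq (k : K) (t : ℝ) : S.g k t = S.q k t + ((S.η * |t| ^ S.r : ℝ) : EReal) := by
  rw [q, g, add_assoc (indicatorFn (S.C k) t + supportFn (S.D k) t), EReal.sub_add_cancel]

theorem isConvexEReal_q (k : K) : IsConvexEReal (S.q k) :=
  ((isConvexEReal_indicatorFn (S.C_interval k)).add (isConvexEReal_supportFn (S.D_nonempty k))).add
    ⟨(S.h_sub_gamma k).ne_bot, (S.h_sub_gamma k).convex⟩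

theorem g_ne_bot (k : K) (t : ℝ) : S.g k t ≠ ⊥ := by
  rw [g_eq, Ne, EReal.add_eq_bot_iff, not_or]
  exact ⟨(S.isConvexEReal_q k).ne_bot t, EReal.coe_ne_bot _⟩

theorem lowerSemicontinuous_g (k : K) : LowerSemicontinuous (S.g k) := by
  have h1 := isConvexEReal_indicatorFn (S.C_interval k)
  have h2 := isConvexEReal_supportFn (S.D_nonempty k)
  exact lowerSemicontinuous_ereal_add
    (lowerSemicontinuous_ereal_add (lowerSemicontinuous_indicatorFn (S.C_closed k))
      (lowerSemicontinuous_supportFn (S.D k)) h1.ne_bot h2.ne_bot)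
    (S.h_gamma k).lsc (h1.add h2).ne_bot (S.h_gamma k).ne_bot

theorem g_zero (k : K) : S.g k 0 = 0 := by
  have : supportFn (S.D k) 0 = 0 := by
    simp only [supportFn, mul_zero, EReal.coe_zero]
    exact biSup_const (S.D_nonempty k)
  simp [g, this, S.h_zero, indicatorFn, S.zero_mem_C]

/-- The size of the part of `Dₖ` that makes `σ_{Dₖ}` negative. -/
def dist0 (k : K) : ℝ := max (max (sInf (S.D k)) 0) (max (-sSup (S.D k)) 0)

theorem dist0_nonneg (k : K) : 0 ≤ S.dist0 k :=
  (le_max_right _ _).trans (le_max_left _ _)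

theorem r_pos : 0 < S.r := by linarith [S.one_lt_r]

/-- The offset making `gₖ` nonnegative. -/
def offset (k : K) : ℝ :=
  (((S.η / 2) ^ (1 / S.r))⁻¹) ^ (S.r / (S.r - 1)) * S.dist0 k ^ (S.r / (S.r - 1))

theorem offset_nonneg (k : K) : 0 ≤ S.offset k := by
  have := S.η_pos
  have := S.dist0_nonneg k
  unfold offset
  positivity

theorem summable_offset : Summable S.offset := by
  have hr := S.one_lt_r
  refine Summable.mul_left _ ?_
  refine Summable.of_nonneg_of_le (fun k => Real.rpow_nonneg (S.dist0_nonneg k) _) (fun k => ?_)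
    (S.D_inf.add S.D_sup)
  have h1 : 0 ≤ max (sInf (S.D k)) 0 ^ (S.r / (S.r - 1)) := Real.rpow_nonneg (le_max_right _ _) _
  have h2 : 0 ≤ max (-sSup (S.D k)) 0 ^ (S.r / (S.r - 1)) := Real.rpow_nonneg (le_max_right _ _) _
  rcases max_choice (max (sInf (S.D k)) 0) (max (-sSup (S.D k)) 0) with h | h
  · rw [dist0, h]
    linarith
  · rw [dist0, h]
    linarith

/-- Young's inequality with `|t|` scaled by `(η / 2) ^ (1 / r)`; the factors `1 / r` and `1 / r*`
are at most `1` and are dropped. Only half of `η` is spent, the other half being kept for coercivity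
in `le_g_add_offset`. -/
theorem dist0_mul_le (k : K) (t : ℝ) :
    S.dist0 k * |t| ≤ S.η / 2 * |t| ^ S.r + S.offset k := by
  have hr := S.one_lt_r
  have hη : 0 < S.η / 2 := by linarith [S.η_pos]
  have hd := S.dist0_nonneg k
  have hconj : S.r.HolderConjugate (S.r / (S.r - 1)) := Real.HolderConjugate.conjExponent hr
  set s := (S.η / 2) ^ (1 / S.r) with hs
  have hs0 : 0 < s := Real.rpow_pos_of_pos hη _
  have hsr : s ^ S.r = S.η / 2 := by
    rw [hs, ← Real.rpow_mul hη.le, one_div, inv_mul_cancel₀ S.r_pos.ne', Real.rpow_one]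
  have h := Real.young_inequality_of_nonneg (mul_nonneg hs0.le (abs_nonneg t))
    (mul_nonneg (inv_nonneg.2 hs0.le) hd) hconj
  rw [Real.mul_rpow hs0.le (abs_nonneg t), Real.mul_rpow (inv_nonneg.2 hs0.le) hd, hsr] at h
  have e : s * |t| * (s⁻¹ * S.dist0 k) = S.dist0 k * |t| := by
    field_simp
  rw [e] at h
  refine h.trans (add_le_add ?_ ?_)
  · exact div_le_self (by positivity) hr.le
  · exact div_le_self (by positivity) hconj.symm.lt.le

theorem q_lower_bound (k : K) (t : ℝ) : ((-(S.dist0 k * |t|) : ℝ) : EReal) ≤ S.q k t := by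
  have h1 : 0 ≤ indicatorFn (S.C k) t := by
    unfold indicatorFn
    split_ifs <;> simp
  have h2 := supportFn_lower_bound (S.D_nonempty k) (S.D_closed k) (S.D_bounded k) t
  have h3 := (S.h_sub_gamma k).nonneg t
  have := add_le_add (add_le_add h1 h2) h3
  simpa [q, dist0] using this

theorem le_g_add_offset (k : K) (t : ℝ) :
    ((S.η / 2 * |t| ^ S.r : ℝ) : EReal) ≤ S.g k t + (S.offset k : EReal) := by
  rw [g_eq]
  refine le_trans ?_ (add_le_add_left (add_le_add_left (S.q_lower_bound k t) _) _)
  norm_cast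
  linarith [S.dist0_mul_le k t]

theorem g_add_offset_nonneg (k : K) (t : ℝ) : 0 ≤ S.g k t + (S.offset k : EReal) := by
  refine le_trans ?_ (S.le_g_add_offset k t)
  have := S.η_pos
  exact EReal.coe_nonneg.2 (by positivity)

/-- The nonnegative version of `gₖ`. -/
def w (k : K) (t : ℝ) : ℝ≥0∞ := (S.g k t + (S.offset k : EReal)).toENNReal

theorem lowerSemicontinuous_w (k : K) : LowerSemicontinuous (S.w k) := by
  have h : LowerSemicontinuous fun t => S.g k t + (S.offset k : EReal) :=
    lowerSemicontinuous_ereal_add (S.lowerSemicontinuous_g k) lowerSemicontinuous_const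
      (S.g_ne_bot k) fun _ => EReal.coe_ne_bot _
  exact EReal.continuous_toENNReal.comp_lowerSemicontinuous h fun _ _ => EReal.toENNReal_le_toENNReal

theorem ofReal_le_w (k : K) (t : ℝ) : ENNReal.ofReal (S.η / 2 * |t| ^ S.r) ≤ S.w k t := by
  have := EReal.toENNReal_le_toENNReal (S.le_g_add_offset k t)
  rwa [EReal.toENNReal_of_ne_top (EReal.coe_ne_top _), EReal.toReal_coe] at this

/-- The modulus of strong convexity of the regularizer. -/
def modulus : ℝ := S.η * (S.r * (S.r - 1) / 2)

theorem modulus_pos : 0 < S.modulus := by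
  have := S.η_pos
  have := S.one_lt_r
  unfold modulus
  have : 0 < S.r - 1 := by linarith
  have := S.r_pos
  positivity

/-- The gain comes only from `η|·|^r`; the remainder `q` is merely convex. An infinite value of `q`
at `a` or `b` makes the right side infinite, and otherwise convexity makes `q` finite in between. -/
theorem w_strongConvex (k : K) {a b m t : ℝ} (ha : |a| ≤ m) (hb : |b| ≤ m) (ht0 : 0 < t)
    (ht1 : t < 1) :
    S.w k ((1 - t) * a + t * b) +
        ENNReal.ofReal (S.modulus * (t * (1 - t))) * ENNReal.ofReal ((b - a) ^ 2 * m ^ (S.r - 2)) ≤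
      ENNReal.ofReal (1 - t) * S.w k a + ENNReal.ofReal t * S.w k b := by
  have ht1' : 0 < 1 - t := by linarith
  have hm : 0 ≤ m := (abs_nonneg a).trans ha
  have hconv := (S.isConvexEReal_q k).convex a b (1 - t) t ht1' ht0 (by ring)
  have hbot := (S.isConvexEReal_q k).ne_bot
  have hpow := strongConvex_abs_rpow S.one_lt_r S.r_le_two ha hb ht0.le ht1.le
  have hga := S.g_add_offset_nonneg k a
  have hgb := S.g_add_offset_nonneg k b
  have hgx := S.g_add_offset_nonneg k ((1 - t) * a + t * b)
  simp only [smul_eq_mul] at hconv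
  unfold w
  simp only [g_eq] at hga hgb hgx ⊢
  induction hA : S.q k a with
  | bot => exact absurd hA (hbot a)
  | top =>
    rw [EReal.top_add_coe, EReal.top_add_coe, EReal.toENNReal_top, ENNReal.mul_top (by simp [ht1]),
      top_add]
    exact le_top
  | coe A =>
  induction hB : S.q k b with
  | bot => exact absurd hB (hbot b)
  | top =>
    rw [EReal.top_add_coe, EReal.top_add_coe, EReal.toENNReal_top, ENNReal.mul_top (by simp [ht0]),
      add_top]
    exact le_top
  | coe B =>
  rw [hA, hB] at hconv
  rw [hA] at hga
  rw [hB] at hgb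
  induction hQ : S.q k ((1 - t) * a + t * b) with
  | bot => exact absurd hQ (hbot _)
  | top =>
    rw [hQ] at hconv
    norm_cast at hconv
  | coe Q =>
  rw [hQ] at hconv hgx
  norm_cast at hconv hga hgb hgx ⊢
  simp only [EReal.toENNReal_of_ne_top (EReal.coe_ne_top _), EReal.toReal_coe]
  have hmod := S.modulus_pos
  rw [← ENNReal.ofReal_mul (by positivity), ← ENNReal.ofReal_mul ht1'.le,
    ← ENNReal.ofReal_mul ht0.le, ← ENNReal.ofReal_add hgx (by positivity),
    ← ENNReal.ofReal_add (by positivity) (by positivity)]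
  refine ENNReal.ofReal_le_ofReal ?_
  have := mul_le_mul_of_nonneg_left hpow S.η_pos.le
  unfold modulus
  nlinarith

/-- The nonnegative version of the regularizer `G`. -/
def W (u : L2 K) : ℝ≥0∞ := ∑' k, S.w k (u k)

theorem lowerSemicontinuous_W : LowerSemicontinuous S.W :=
  lowerSemicontinuous_tsum fun k => (S.lowerSemicontinuous_w k).comp (continuous_coord k)

theorem G_eq (u : L2 K) : S.G u = (S.W u : EReal) - ((∑' k, S.offset k : ℝ) : EReal) :=
  extSum_eq_sub S.offset_nonneg S.summable_offset fun k => S.g_add_offset_nonneg k (u k)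

theorem W_zero_ne_top : S.W 0 ≠ ⊤ := by
  have h : ∀ k, S.w k ((0 : L2 K) k) = ENNReal.ofReal (S.offset k) := fun k => by
    simp [w, g_zero]
  simp only [W, h]
  exact S.summable_offset.tsum_ofReal_ne_top

theorem lrENorm_rpow_le_W (u : L2 K) :
    ENNReal.ofReal (S.η / 2) * lrENorm S.r u ^ S.r ≤ S.W u := by
  rw [lrENorm_rpow S.r_pos, ← ENNReal.tsum_mul_left]
  refine ENNReal.tsum_le_tsum fun k => le_trans (le_of_eq ?_) (S.ofReal_le_w k (u k))
  rw [ENNReal.ofReal_mul (by linarith [S.η_pos]), Real.enorm_eq_ofReal_abs,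
    ENNReal.ofReal_rpow_of_nonneg (abs_nonneg _) S.r_pos.le]

theorem lrENorm_ne_top {u : L2 K} (hu : S.W u ≠ ⊤) : lrENorm S.r u ≠ ⊤ := by
  intro h
  have := S.lrENorm_rpow_le_W u
  rw [h, ENNReal.top_rpow_of_pos S.r_pos, ENNReal.mul_top] at this
  · exact hu (top_le_iff.1 this)
  · simp [S.η_pos]

/-- The weighted quadratic sum that measures the strong convexity of `G` between `u` and `v`. -/
def gap (m : K → ℝ) (u v : L2 K) : ℝ≥0∞ :=
  ∑' k, ENNReal.ofReal ((v k - u k) ^ 2 * m k ^ (S.r - 2))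

theorem gap_comm (m : K → ℝ) (u v : L2 K) : S.gap m u v = S.gap m v u := by
  simp only [gap, sub_sq_comm]

/-- Sum the scalar inequality termwise; with terms in `[0, ∞]` no summability is at stake. The
dominating family `m` is left free so that `stability` can choose one adapted to its denominator. -/
theorem W_strongConvex {m : K → ℝ} {u v : L2 K} (hu : ∀ k, |u k| ≤ m k) (hv : ∀ k, |v k| ≤ m k)
    {t : ℝ} (ht0 : 0 < t) (ht1 : t < 1) :
    S.W (u + t • (v - u)) + ENNReal.ofReal (S.modulus * (t * (1 - t))) * S.gap m u v ≤
      ENNReal.ofReal (1 - t) * S.W u + ENNReal.ofReal t * S.W v := by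
  simp only [W, gap, ← ENNReal.tsum_mul_left]
  rw [← ENNReal.tsum_add, ← ENNReal.tsum_add]
  refine ENNReal.tsum_le_tsum fun k => ?_
  have e : (u + t • (v - u)) k = (1 - t) * u k + t * v k := by
    simp only [lp.coeFn_add, lp.coeFn_smul, lp.coeFn_sub, Pi.add_apply, Pi.smul_apply,
      Pi.sub_apply, smul_eq_mul]
    ring
  rw [e]
  exact S.w_strongConvex k (hu k) (hv k) ht0 ht1

theorem lrENorm_sub_sq_le_gap {m : K → ℝ} {u v : L2 K} (hu : ∀ k, |u k| ≤ m k)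
    (hv : ∀ k, |v k| ≤ m k) :
    lrENorm S.r (v - u) ^ 2 ≤ S.gap m u v * lrENorm S.r m ^ (2 - S.r) := by
  refine lrENorm_sq_le S.r_pos S.r_le_two (fun k => (abs_nonneg _).trans (hu k)) fun k hk => ?_
  have h1 : u k = 0 := abs_eq_zero.1 (le_antisymm ((hu k).trans_eq hk) (abs_nonneg _))
  have h2 : v k = 0 := abs_eq_zero.1 (le_antisymm ((hv k).trans_eq hk) (abs_nonneg _))
  simp [h1, h2]

end Setting


/-! ### Existence of minimizers from closeness of near-minimizers. -/

section Minimization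

/-- A lower semicontinuous function on a complete space whose near-minimizers are close to each
other has a minimizer. -/
theorem exists_minimizer_of_edist_sq_le {H : Type*} [EMetricSpace H] [CompleteSpace H]
    {J : H → ℝ≥0∞} (hJ : LowerSemicontinuous J) (hfin : (⨅ x, J x) ≠ ⊤) {c : ℝ≥0∞} (hc : c ≠ ⊤)
    (hclose : ∀ δ ≤ 1, ∀ u v, J u ≤ (⨅ x, J x) + δ → J v ≤ (⨅ x, J x) + δ →
      edist u v ^ 2 ≤ c * δ) :
    ∃ u, ∀ v, J u ≤ J v := by
  set i := ⨅ x, J x with hi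
  set δ : ℕ → ℝ≥0∞ := fun n => (n + 1 : ℝ≥0∞)⁻¹ with hδ
  have hδpos : ∀ n, 0 < δ n := fun n => by
    simp [hδ, ENNReal.add_eq_top]
  have hδ1 : ∀ n, δ n ≤ 1 := fun n => by
    simp [hδ, ENNReal.inv_le_one]
  have hδanti : Antitone δ := fun m n hmn => by
    simp only [hδ]
    gcongr
  have hδ0 : Tendsto δ atTop (𝓝 0) := by
    have := (tendsto_add_atTop_iff_nat 1).2 ENNReal.tendsto_inv_nat_nhds_zero
    simpa [hδ] using this
  have hex : ∀ n, ∃ x, J x ≤ i + δ n := fun n => by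
    obtain ⟨x, hx⟩ := iInf_lt_iff.1 (ENNReal.lt_add_right hfin (hδpos n).ne')
    exact ⟨x, hx.le⟩
  choose x hx using hex
  have hcau : CauchySeq x := by
    rw [EMetric.cauchySeq_iff]
    intro ε hε
    have h1 : Tendsto (fun n => c * δ n) atTop (𝓝 0) := by
      simpa using ENNReal.Tendsto.const_mul hδ0 (Or.inr hc)
    have h2 : (0 : ℝ≥0∞) < ε ^ 2 := ENNReal.pow_pos hε 2
    obtain ⟨n, hn⟩ := (h1.eventually_lt_const h2).exists
    refine ⟨n, fun p hp q hq => ?_⟩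
    have h3 := hclose (δ n) (hδ1 n) (x p) (x q)
      ((hx p).trans (add_le_add le_rfl (hδanti hp))) ((hx q).trans (add_le_add le_rfl (hδanti hq)))
    exact (ENNReal.pow_lt_pow_left_iff two_ne_zero).1 (h3.trans_lt hn)
  obtain ⟨a, ha⟩ := cauchySeq_tendsto_of_complete hcau
  refine ⟨a, fun v => le_trans ?_ (iInf_le J v)⟩
  -- A value strictly between the infimum and `J a` would, by lower semicontinuity, be exceeded by
  -- `J (x n)` for large `n`, although `J (x n)` is at most `i + δ n`.
  by_contra! h
  obtain ⟨y, hy1, hy2⟩ := exists_between h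
  have h1 := ha.eventually (hJ a y hy2)
  have h2 : Tendsto (fun n => i + δ n) atTop (𝓝 i) := by
    simpa using hδ0.const_add i
  obtain ⟨n, hn1, hn2⟩ := (h1.and (h2.eventually_lt_const hy1)).exists
  exact absurd ((hx n).trans_lt hn2) (not_lt.2 hn1.le)

theorem le_of_forall_le_add_mul {a b c : ℝ} (h : ∀ t : ℝ, 0 < t → t < 1 → a ≤ b + t * c) :
    a ≤ b := by
  have h1 : Tendsto (fun t : ℝ => b + t * c) (𝓝[>] 0) (𝓝 b) := by
    have : Tendsto (fun t : ℝ => b + t * c) (𝓝 0) (𝓝 (b + 0 * c)) :=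
      (continuous_const.add (continuous_id.mul continuous_const)).tendsto 0
    simpa using this.mono_left nhdsWithin_le_nhds
  refine ge_of_tendsto h1 ?_
  filter_upwards [Ioo_mem_nhdsGT (zero_lt_one' ℝ)] with t ht
  exact h t ht.1 ht.2

end Minimization

/-! ### Convex quadratic functionals. -/

section Quadratic

variable {H : Type*} [NormedAddCommGroup H] [InnerProductSpace ℝ H]

/-- A nonnegative convex continuous quadratic function with gradient `grad` and second-order
part `B`. -/
structure IsQuadratic (Q : H → ℝ) (grad : H → H) (B : H → ℝ) (c : ℝ) : Prop where
  nonneg : ∀ u, 0 ≤ Q u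
  expand : ∀ u d : H, ∀ t : ℝ, Q (u + t • d) = Q u + t * inner ℝ (grad u) d + t ^ 2 * B d
  B_nonneg : ∀ d, 0 ≤ B d
  B_le : ∀ d, B d ≤ c * ‖d‖ ^ 2

/-- Convexity of an `[0, ∞]`-valued function. -/
def IsConvexENNReal (A : H → ℝ≥0∞) : Prop :=
  ∀ u v : H, ∀ t : ℝ, 0 < t → t < 1 →
    A (u + t • (v - u)) ≤ ENNReal.ofReal (1 - t) * A u + ENNReal.ofReal t * A v

namespace IsQuadratic

variable {Q : H → ℝ} {grad : H → H} {B : H → ℝ} {c : ℝ}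

theorem expand_sub (hQ : IsQuadratic Q grad B c) (u v : H) :
    Q v = Q u + inner ℝ (grad u) (v - u) + B (v - u) := by
  have := hQ.expand u (v - u) 1
  simpa using this

theorem continuous (hQ : IsQuadratic Q grad B c) : Continuous Q := by
  rw [continuous_iff_continuousAt]
  intro u
  have hB : Tendsto (fun v => B (v - u)) (𝓝 u) (𝓝 0) := by
    refine squeeze_zero (fun v => hQ.B_nonneg _) (fun v => hQ.B_le _) ?_
    have : Tendsto (fun v : H => c * ‖v - u‖ ^ 2) (𝓝 u) (𝓝 (c * ‖u - u‖ ^ 2)) :=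
      Continuous.tendsto (by fun_prop) u
    simpa using this
  have hin : Tendsto (fun v => inner ℝ (grad u) (v - u)) (𝓝 u) (𝓝 (inner ℝ (grad u) (u - u))) :=
    Continuous.tendsto (by fun_prop) u
  have h := (hin.const_add (Q u)).add hB
  simp only [sub_self, inner_zero_right, add_zero] at h
  exact h.congr fun v => (hQ.expand_sub u v).symm

theorem isConvexENNReal (hQ : IsQuadratic Q grad B c) :
    IsConvexENNReal fun u => ENNReal.ofReal (Q u) := by
  intro u v t ht0 ht1
  have ht1' : 0 < 1 - t := by linarith
  rw [← ENNReal.ofReal_mul ht1'.le, ← ENNReal.ofReal_mul ht0.le,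
    ← ENNReal.ofReal_add (mul_nonneg ht1'.le (hQ.nonneg u)) (mul_nonneg ht0.le (hQ.nonneg v))]
  refine ENNReal.ofReal_le_ofReal ?_
  rw [hQ.expand, hQ.expand_sub u v]
  nlinarith [mul_nonneg (mul_pos ht0 ht1').le (hQ.B_nonneg (v - u))]

/-- The gradient is monotone: add the two exact expansions and discard the nonnegative second-order
parts. -/
theorem inner_grad_le (hQ : IsQuadratic Q grad B c) (u v : H) :
    inner ℝ (grad v) (u - v) ≤ inner ℝ (grad u) (u - v) := by
  have h1 := hQ.expand_sub u v
  have h2 := hQ.expand_sub v u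
  have h3 : inner ℝ (grad u) (v - u) = -inner ℝ (grad u) (u - v) := by
    rw [← inner_neg_right, neg_sub]
  linarith [hQ.B_nonneg (v - u), hQ.B_nonneg (u - v)]

end IsQuadratic

end Quadratic

/-! ### Regularized objectives: existence, uniqueness and first-order conditions. -/

namespace Setting

variable {X K : Type*} [MeasurableSpace X] (S : Setting X K)

/-- The objective `A + lam W`. -/
def objective (A : L2 K → ℝ≥0∞) (lam : ℝ) (u : L2 K) : ℝ≥0∞ :=
  A u + ENNReal.ofReal lam * S.W u

variable {S}

theorem W_ne_top_of_objective {A : L2 K → ℝ≥0∞} {lam : ℝ} (hlam : 0 < lam) {u : L2 K}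
    (h : S.objective A lam u ≠ ⊤) : S.W u ≠ ⊤ := by
  intro hW
  refine h ?_
  rw [objective, hW, ENNReal.mul_top (by simpa using hlam), add_top]

theorem lowerSemicontinuous_objective {A : L2 K → ℝ≥0∞} (hA : LowerSemicontinuous A) (lam : ℝ) :
    LowerSemicontinuous (S.objective A lam) :=
  hA.add ((ENNReal.continuous_const_mul ENNReal.ofReal_ne_top).comp_lowerSemicontinuous
    S.lowerSemicontinuous_W fun _ _ h => mul_le_mul_right h _)

/-- The midpoint of `u` and `v` has objective at least the infimum, while strong convexity places it
below the average of the endpoint values by the left-hand side; that gain is therefore at most `δ`.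
-/
theorem objective_gap_le {A : L2 K → ℝ≥0∞} (hA : IsConvexENNReal A) {lam : ℝ}
    (hfin : (⨅ x, S.objective A lam x) ≠ ⊤) {m : K → ℝ} {u v : L2 K} (hmu : ∀ k, |u k| ≤ m k)
    (hmv : ∀ k, |v k| ≤ m k) {δ : ℝ≥0∞} (hu : S.objective A lam u ≤ (⨅ x, S.objective A lam x) + δ)
    (hv : S.objective A lam v ≤ (⨅ x, S.objective A lam x) + δ) :
    ENNReal.ofReal lam * ENNReal.ofReal (S.modulus * (1 / 4)) * S.gap m u v ≤ δ := by
  set i := ⨅ x, S.objective A lam x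
  have hW := S.W_strongConvex hmu hmv (t := 1 / 2) (by norm_num) (by norm_num)
  have hAc := hA u v (1 / 2) (by norm_num) (by norm_num)
  have e1 : (1 - 1 / 2 : ℝ) = 1 / 2 := by norm_num
  have e2 : (1 / 2 * (1 / 2) : ℝ) = 1 / 4 := by norm_num
  rw [e1] at hAc hW
  rw [e2] at hW
  set x := u + (1 / 2 : ℝ) • (v - u)
  set h := ENNReal.ofReal (1 / 2)
  set L := ENNReal.ofReal lam
  set G := ENNReal.ofReal (S.modulus * (1 / 4)) * S.gap m u v
  have hh : h + h = 1 := by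
    rw [← ENNReal.ofReal_add (by norm_num) (by norm_num)]
    norm_num
  have key : i + L * G ≤ i + δ := by
    calc i + L * G ≤ (A x + L * S.W x) + L * G := add_le_add (iInf_le _ x) le_rfl
      _ = A x + L * (S.W x + G) := by ring
      _ ≤ (h * A u + h * A v) + L * (h * S.W u + h * S.W v) := by gcongr
      _ = h * (S.objective A lam u) + h * (S.objective A lam v) := by
        simp only [objective]
        ring
      _ ≤ h * (i + δ) + h * (i + δ) := by gcongr
      _ = i + δ := by rw [← add_mul, hh, one_mul]
  rw [mul_assoc]
  exact (ENNReal.add_le_add_iff_left hfin).1 key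

theorem lrENorm_le_of_objective {A : L2 K → ℝ≥0∞} {lam : ℝ} (hlam : 0 < lam) {u : L2 K}
    {a : ℝ≥0∞} (h : S.objective A lam u ≤ a) :
    lrENorm S.r u ≤ (a / (ENNReal.ofReal lam * ENNReal.ofReal (S.η / 2))) ^ (1 / S.r) := by
  have hη := S.η_pos
  rw [one_div, ENNReal.le_rpow_inv_iff S.r_pos, ENNReal.le_div_iff_mul_le (Or.inl (by simp [hlam, hη]))
    (Or.inl (ENNReal.mul_ne_top ENNReal.ofReal_ne_top ENNReal.ofReal_ne_top))]
  calc lrENorm S.r u ^ S.r * (ENNReal.ofReal lam * ENNReal.ofReal (S.η / 2))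
      = ENNReal.ofReal lam * (ENNReal.ofReal (S.η / 2) * lrENorm S.r u ^ S.r) := by ring
    _ ≤ ENNReal.ofReal lam * S.W u := by gcongr; exact S.lrENorm_rpow_le_W u
    _ ≤ a := le_trans le_add_self h

/-- Taking `δ ≤ 1` puts all near-minimizers in one `ℓ^r` ball of radius `R`, so the factor `‖m‖_r ^
(2 - r)` is bounded uniformly. The case `δ = 0` gives uniqueness. -/
theorem exists_objective_edist_sq_le {A : L2 K → ℝ≥0∞} (hA : IsConvexENNReal A) {lam : ℝ}
    (hlam : 0 < lam) (hfin : (⨅ x, S.objective A lam x) ≠ ⊤) :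
    ∃ c : ℝ≥0∞, c ≠ ⊤ ∧ ∀ δ ≤ 1, ∀ u v, S.objective A lam u ≤ (⨅ x, S.objective A lam x) + δ →
      S.objective A lam v ≤ (⨅ x, S.objective A lam x) + δ → edist u v ^ 2 ≤ c * δ := by
  have hη := S.η_pos
  have hmod := S.modulus_pos
  set i := ⨅ x, S.objective A lam x
  set R := ((i + 1) / (ENNReal.ofReal lam * ENNReal.ofReal (S.η / 2))) ^ (1 / S.r) with hR
  set M := ENNReal.ofReal lam * ENNReal.ofReal (S.modulus * (1 / 4)) with hM
  have hM0 : M ≠ 0 := by simp [hM, hlam, hmod]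
  have hMt : M ≠ ⊤ := ENNReal.mul_ne_top ENNReal.ofReal_ne_top ENNReal.ofReal_ne_top
  have hRt : R ≠ ⊤ := by
    refine ENNReal.rpow_ne_top_of_nonneg (by have := S.r_pos; positivity) ?_
    exact ENNReal.div_ne_top (ENNReal.add_ne_top.2 ⟨hfin, ENNReal.one_ne_top⟩) (by simp [hlam, hη])
  have hr2 : 0 ≤ 2 - S.r := by linarith [S.r_le_two]
  refine ⟨M⁻¹ * (R + R) ^ (2 - S.r), ?_, fun δ hδ u v hu hv => ?_⟩
  · exact ENNReal.mul_ne_top (ENNReal.inv_ne_top.2 hM0)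
      (ENNReal.rpow_ne_top_of_nonneg hr2 (ENNReal.add_ne_top.2 ⟨hRt, hRt⟩))
  have hmu : ∀ k, |u k| ≤ |u k| + |v k| := fun k => le_add_of_nonneg_right (abs_nonneg _)
  have hmv : ∀ k, |v k| ≤ |u k| + |v k| := fun k => le_add_of_nonneg_left (abs_nonneg _)
  have hgap := objective_gap_le hA hfin hmu hmv hu hv
  have hgap' : S.gap (fun k => |u k| + |v k|) u v ≤ M⁻¹ * δ := by
    rw [mul_comm, ← div_eq_mul_inv, ENNReal.le_div_iff_mul_le (Or.inl hM0) (Or.inl hMt), mul_comm]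
    exact hgap
  have hNu : lrENorm S.r u ≤ R := lrENorm_le_of_objective hlam (hu.trans (by gcongr))
  have hNv : lrENorm S.r v ≤ R := lrENorm_le_of_objective hlam (hv.trans (by gcongr))
  have hNm : lrENorm S.r (fun k => |u k| + |v k|) ≤ R + R := by
    refine (lrENorm_add_le S.one_lt_r.le (fun k => |u k|) (fun k => |v k|)).trans ?_
    rw [lrENorm_abs, lrENorm_abs]
    exact add_le_add hNu hNv
  calc edist u v ^ 2 ≤ lrENorm S.r (v - u) ^ 2 := by
        rw [edist_comm, edist_eq_enorm_sub]
        gcongr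
        exact enorm_le_lrENorm S.r_pos S.r_le_two (v - u)
    _ ≤ _ := S.lrENorm_sub_sq_le_gap hmu hmv
    _ ≤ (M⁻¹ * δ) * (R + R) ^ (2 - S.r) := by gcongr
    _ = _ := by ring

theorem exists_minimizer {A : L2 K → ℝ≥0∞} (hAl : LowerSemicontinuous A) (hA : IsConvexENNReal A)
    {lam : ℝ} (hlam : 0 < lam) {u₀ : L2 K} (h₀ : S.objective A lam u₀ ≠ ⊤) :
    ∃ u, ∀ v, S.objective A lam u ≤ S.objective A lam v := by
  have hfin : (⨅ x, S.objective A lam x) ≠ ⊤ := ne_top_of_le_ne_top h₀ (iInf_le _ _)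
  obtain ⟨c, hc, h⟩ := exists_objective_edist_sq_le hA hlam hfin
  exact exists_minimizer_of_edist_sq_le (lowerSemicontinuous_objective hAl lam) hfin hc h

theorem minimizer_unique {A : L2 K → ℝ≥0∞} (hA : IsConvexENNReal A)
    {lam : ℝ} (hlam : 0 < lam) {u₀ : L2 K} (h₀ : S.objective A lam u₀ ≠ ⊤) {u v : L2 K}
    (hu : ∀ x, S.objective A lam u ≤ S.objective A lam x)
    (hv : ∀ x, S.objective A lam v ≤ S.objective A lam x) : u = v := by
  have hfin : (⨅ x, S.objective A lam x) ≠ ⊤ := ne_top_of_le_ne_top h₀ (iInf_le _ _)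
  obtain ⟨c, -, h⟩ := exists_objective_edist_sq_le hA hlam hfin
  have := h 0 zero_le_one u v (by simpa using le_iInf hu) (by simpa using le_iInf hv)
  simpa using this

/-- First-order condition with the gain of strong convexity, for a point that minimizes
`Q + lam W` along a segment up to an error `t e`. -/
theorem first_order {Q B : L2 K → ℝ} {grad : L2 K → L2 K} {c : ℝ} (hQ : IsQuadratic Q grad B c)
    {lam e : ℝ} (hlam : 0 < lam) (he : 0 ≤ e) {m : K → ℝ} {u v : L2 K} (hmu : ∀ k, |u k| ≤ m k)
    (hmv : ∀ k, |v k| ≤ m k) (hWu : S.W u ≠ ⊤) (hWv : S.W v ≠ ⊤)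
    (hmin : ∀ t : ℝ, 0 < t → t < 1 →
      S.objective (fun x => ENNReal.ofReal (Q x)) lam u ≤
        S.objective (fun x => ENNReal.ofReal (Q x)) lam (u + t • (v - u)) +
          ENNReal.ofReal (t * e)) :
    S.gap m u v ≠ ⊤ ∧
    lam * S.modulus * (S.gap m u v).toReal ≤
      lam * ((S.W v).toReal - (S.W u).toReal) + inner ℝ (grad u) (v - u) + e := by
  have hmod := S.modulus_pos
  have hbound : ∀ t : ℝ, ENNReal.ofReal (1 - t) * S.W u + ENNReal.ofReal t * S.W v ≠ ⊤ :=
    fun t => ENNReal.add_ne_top.2 ⟨ENNReal.mul_ne_top ENNReal.ofReal_ne_top hWu,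
      ENNReal.mul_ne_top ENNReal.ofReal_ne_top hWv⟩
  have hgap : S.gap m u v ≠ ⊤ := by
    intro h
    have h1 := S.W_strongConvex hmu hmv (t := 1 / 2) (by norm_num) (by norm_num)
    rw [h, ENNReal.mul_top (by simp [hmod]; norm_num), add_top] at h1
    exact hbound _ (top_le_iff.1 h1)
  -- After division by `t`, the term of order `t` collects the second-order part `B (v - u)` and the
  -- loss from replacing `1 - t` by `1` in the gain.
  refine ⟨hgap, le_of_forall_le_add_mul
    (c := B (v - u) + lam * S.modulus * (S.gap m u v).toReal) fun t ht0 ht1 => ?_⟩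
  have ht1' : 0 < 1 - t := by linarith
  have h1 := S.W_strongConvex hmu hmv ht0 ht1
  have hWx : S.W (u + t • (v - u)) ≠ ⊤ :=
    ne_top_of_le_ne_top (hbound t) (le_self_add.trans h1)
  have h2 := hmin t ht0 ht1
  simp only [objective] at h2
  have hx := hQ.expand u (v - u) t
  have hQx := hQ.nonneg (u + t • (v - u))
  have hQu := hQ.nonneg u
  rw [← ENNReal.ofReal_toReal hWx, ← ENNReal.ofReal_toReal hWu, ← ENNReal.ofReal_toReal hWv,
    ← ENNReal.ofReal_toReal hgap, ← ENNReal.ofReal_mul (by positivity),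
    ← ENNReal.ofReal_mul (by positivity), ← ENNReal.ofReal_mul (by positivity),
    ← ENNReal.ofReal_add (by positivity) (by positivity),
    ← ENNReal.ofReal_add (by positivity) (by positivity),
    ENNReal.ofReal_le_ofReal_iff (by positivity)] at h1
  rw [← ENNReal.ofReal_toReal hWx, ← ENNReal.ofReal_toReal hWu, ← ENNReal.ofReal_mul hlam.le,
    ← ENNReal.ofReal_mul hlam.le, ← ENNReal.ofReal_add (by positivity) (by positivity),
    ← ENNReal.ofReal_add (by positivity) (by positivity),
    ← ENNReal.ofReal_add (by positivity) (by positivity),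
    ENNReal.ofReal_le_ofReal_iff (by positivity), hx] at h2
  have h3 := mul_le_mul_of_nonneg_left h1 hlam.le
  refine le_of_mul_le_mul_left ?_ ht0
  nlinarith

end Setting

/-! ### The true and empirical risks as quadratic functionals. -/

namespace Setting

variable {X K : Type*} [MeasurableSpace X] (S : Setting X K)

theorem f_eq_inner (u : L2 K) (x : X) : S.f u x = inner ℝ u (S.featureMap x) := by
  rw [lp.inner_eq_tsum]
  exact tsum_congr fun k => by simp [featureMap, mul_comm]

theorem norm_featureMap_le (x : X) : ‖S.featureMap x‖ ≤ S.κ := by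
  have h := lp.norm_rpow_eq_tsum (p := 2) (by norm_num) (S.featureMap x)
  simp only [ENNReal.toReal_ofNat, Real.rpow_ofNat] at h
  refine (sq_le_sq₀ (norm_nonneg _) S.κ_pos.le).1 (h.trans_le ?_)
  simpa [featureMap] using S.φ_bound x

theorem abs_f_le (u : L2 K) (x : X) : |S.f u x| ≤ S.κ * ‖u‖ := by
  rw [f_eq_inner, mul_comm]
  exact (abs_real_inner_le_norm _ _).trans
    (mul_le_mul_of_nonneg_left (S.norm_featureMap_le x) (norm_nonneg _))

theorem abs_le_b (y : S.Y) : |(y : ℝ)| ≤ S.b := by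
  obtain ⟨R, hR⟩ := S.Y_bounded.exists_norm_le
  refine le_csSup ⟨R, ?_⟩ ⟨y, y.2, rfl⟩
  rintro _ ⟨x, hx, rfl⟩
  exact hR x hx

theorem abs_residual_le (u : L2 K) (z : X × S.Y) :
    |S.f u z.1 - (z.2 : ℝ)| ≤ S.κ * ‖u‖ + S.b :=
  (abs_sub _ _).trans (add_le_add (S.abs_f_le u z.1) (S.abs_le_b z.2))

theorem norm_Psi_le_residual (u : L2 K) (z : X × S.Y) :
    ‖S.Psi u z‖ ≤ 2 * S.κ * |S.f u z.1 - (z.2 : ℝ)| := by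
  rw [Psi, norm_smul, Real.norm_eq_abs, abs_mul, abs_two]
  have := mul_le_mul_of_nonneg_left (S.norm_featureMap_le z.1)
    (by positivity : 0 ≤ 2 * |S.f u z.1 - (z.2 : ℝ)|)
  linarith

theorem norm_Psi_le (u : L2 K) (z : X × S.Y) :
    ‖S.Psi u z‖ ≤ 2 * S.κ * (S.κ * ‖u‖ + S.b) :=
  (S.norm_Psi_le_residual u z).trans
    (mul_le_mul_of_nonneg_left (S.abs_residual_le u z) (by linarith [S.κ_pos]))

/-- The feature map is the pointwise limit of its finite partial sums; countability of `K` makes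
`atTop` on `Finset K` countably generated. -/
theorem stronglyMeasurable_featureMap [Countable K] : StronglyMeasurable S.featureMap := by
  classical
  refine stronglyMeasurable_of_tendsto (atTop : Filter (Finset K))
    (f := fun s x => ∑ k ∈ s, lp.single 2 k (S.φ k x)) (fun s => ?_) ?_
  · refine Finset.stronglyMeasurable_fun_sum s fun k _ => ?_
    have hcont : Continuous fun a : ℝ => (lp.single 2 k a : L2 K) :=
      (lp.isometry_single (E := fun _ : K => ℝ) k).continuous
    exact hcont.comp_stronglyMeasurable (S.φ_meas k).stronglyMeasurable
  · rw [tendsto_pi_nhds]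
    intro x
    exact lp.hasSum_single (by norm_num) (S.featureMap x)

theorem stronglyMeasurable_f [Countable K] (u : L2 K) : StronglyMeasurable (S.f u) := by
  have : S.f u = fun x => inner ℝ u (S.featureMap x) := funext (S.f_eq_inner u)
  rw [this]
  exact StronglyMeasurable.inner stronglyMeasurable_const S.stronglyMeasurable_featureMap

theorem stronglyMeasurable_residual [Countable K] (u : L2 K) :
    StronglyMeasurable fun z : X × S.Y => S.f u z.1 - (z.2 : ℝ) :=
  ((S.stronglyMeasurable_f u).comp_measurable measurable_fst).sub
    (measurable_subtype_coe.comp measurable_snd).stronglyMeasurable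

theorem stronglyMeasurable_Psi [Countable K] (u : L2 K) : StronglyMeasurable (S.Psi u) :=
  ((S.stronglyMeasurable_residual u).const_mul 2).smul
    (S.stronglyMeasurable_featureMap.comp_measurable measurable_fst)

theorem memLp_Psi [Countable K] (u : L2 K) (p : ℝ≥0∞) : MemLp (S.Psi u) p S.P :=
  have := S.P_prob
  MemLp.of_bound (S.stronglyMeasurable_Psi u).aestronglyMeasurable _
    (Eventually.of_forall (S.norm_Psi_le u))

theorem memLp_residual [Countable K] (u : L2 K) (p : ℝ≥0∞) :
    MemLp (fun z : X × S.Y => S.f u z.1 - (z.2 : ℝ)) p S.P :=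
  have := S.P_prob
  MemLp.of_bound (S.stronglyMeasurable_residual u).aestronglyMeasurable _
    (Eventually.of_forall (S.abs_residual_le u))

theorem eLpNorm_Psi_le [Countable K] (u : L2 K) :
    eLpNorm (S.Psi u) 2 S.P ≤ ENNReal.ofReal (2 * S.κ * √(S.risk (S.f u))) := by
  have h1 := eLpNorm_le_mul_eLpNorm_of_ae_le_mul (p := 2) (μ := S.P)
    (f := S.Psi u) (g := fun z : X × S.Y => S.f u z.1 - (z.2 : ℝ)) (c := 2 * S.κ)
    (Eventually.of_forall (S.norm_Psi_le_residual u))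
  refine h1.trans_eq ?_
  rw [(S.memLp_residual u 2).eLpNorm_eq_integral_rpow_norm (by norm_num) (by norm_num),
    ← ENNReal.ofReal_mul (by linarith [S.κ_pos])]
  simp [risk, Real.sqrt_eq_rpow]

theorem sq_residual_expand (u d : L2 K) (t : ℝ) (z : X × S.Y) :
    |S.f (u + t • d) z.1 - (z.2 : ℝ)| ^ 2 =
      |S.f u z.1 - (z.2 : ℝ)| ^ 2 + t * inner ℝ (S.Psi u z) d + t ^ 2 * S.f d z.1 ^ 2 := by
  simp only [sq_abs, Psi, f_eq_inner, inner_add_left, real_inner_smul_left,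
    real_inner_comm d (S.featureMap z.1)]
  ring

theorem f_sq_le (d : L2 K) (x : X) : S.f d x ^ 2 ≤ S.κ ^ 2 * ‖d‖ ^ 2 := by
  rw [← mul_pow, ← sq_abs]
  exact pow_le_pow_left₀ (abs_nonneg _) (S.abs_f_le d x) 2

theorem isQuadratic_F [Countable K] :
    IsQuadratic S.F (fun u => ∫ z, S.Psi u z ∂S.P) (fun d => ∫ z, S.f d z.1 ^ 2 ∂S.P)
      (S.κ ^ 2) := by
  have := S.P_prob
  have hB : ∀ d, Integrable (fun z : X × S.Y => S.f d z.1 ^ 2) S.P := fun d => by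
    refine Integrable.of_bound ((((S.stronglyMeasurable_f d).comp_measurable
      measurable_fst).pow 2).aestronglyMeasurable) (S.κ ^ 2 * ‖d‖ ^ 2)
      (Eventually.of_forall fun z => ?_)
    rw [Real.norm_of_nonneg (sq_nonneg _)]
    exact S.f_sq_le d z.1
  have hres : ∀ u, Integrable (fun z : X × S.Y => |S.f u z.1 - (z.2 : ℝ)| ^ 2) S.P := fun u =>
    (S.memLp_residual u 2).abs.integrable_sq
  have hPsi : ∀ u, Integrable (S.Psi u) S.P := fun u =>
    memLp_one_iff_integrable.1 (S.memLp_Psi u 1)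
  refine ⟨fun u => integral_nonneg fun z => by positivity, fun u d t => ?_,
    fun d => integral_nonneg fun z => by positivity, fun d => ?_⟩
  · have hin : Integrable (fun z => inner ℝ (S.Psi u z) d) S.P := (hPsi u).inner_const d
    simp only [F, risk, S.sq_residual_expand]
    have hadd : Integrable (fun z : X × S.Y => |S.f u z.1 - (z.2 : ℝ)| ^ 2 +
        t * inner ℝ (S.Psi u z) d) S.P := (hres u).add (hin.const_mul t)
    rw [integral_add hadd ((hB d).const_mul _), integral_add (hres u) (hin.const_mul t),
      integral_const_mul, integral_const_mul]
    have : ∫ z, inner ℝ (S.Psi u z) d ∂S.P = inner ℝ (∫ z, S.Psi u z ∂S.P) d := by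
      rw [real_inner_comm, ← integral_inner (hPsi u)]
      simp only [real_inner_comm]
    rw [this]
  · have h := integral_mono (hB d) (integrable_const (S.κ ^ 2 * ‖d‖ ^ 2))
      fun z => S.f_sq_le d z.1
    simpa using h

theorem isQuadratic_empirical {n : ℕ} (hn : 0 < n) (z : Fin n → X × S.Y) :
    IsQuadratic (fun u => 1 / (n : ℝ) * ∑ i, |S.f u (z i).1 - ((z i).2 : ℝ)| ^ 2)
      (fun u => (1 / (n : ℝ)) • ∑ i, S.Psi u (z i))
      (fun d => 1 / (n : ℝ) * ∑ i, S.f d (z i).1 ^ 2) (S.κ ^ 2) := by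
  have hn' : (0 : ℝ) < n := Nat.cast_pos.2 hn
  refine ⟨fun u => by positivity, fun u d t => ?_, fun d => by positivity, fun d => ?_⟩
  · simp only [S.sq_residual_expand, Finset.sum_add_distrib, ← Finset.mul_sum,
      real_inner_smul_left, sum_inner]
    ring
  · have h := Finset.sum_le_card_nsmul Finset.univ (fun i => S.f d (z i).1 ^ 2)
      (S.κ ^ 2 * ‖d‖ ^ 2) fun i _ => S.f_sq_le d (z i).1
    simp only [Finset.card_univ, Fintype.card_fin, nsmul_eq_mul] at h
    rw [one_div, inv_mul_le_iff₀ hn']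
    exact h

end Setting

/-- Removes the common finite constant, so that comparisons of the original objectives become
comparisons in `[0, ∞]`. -/
theorem ereal_coe_sub_le_iff {a b : ℝ≥0∞} {c e : ℝ} (he : 0 ≤ e) :
    (a : EReal) - (c : EReal) ≤ (b : EReal) - (c : EReal) + (e : EReal) ↔
      a ≤ b + ENNReal.ofReal e := by
  have h1 : (b : EReal) - (c : EReal) + (e : EReal) = ((b + ENNReal.ofReal e : ℝ≥0∞) : EReal) - c := by
    rw [EReal.coe_ennreal_add, EReal.coe_ennreal_ofReal, max_eq_left he, sub_eq_add_neg,
      sub_eq_add_neg, add_right_comm]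
  rw [h1]
  constructor
  · intro h
    have h2 := add_le_add_left h (c : EReal)
    rwa [EReal.sub_add_cancel, EReal.sub_add_cancel, EReal.coe_ennreal_le_coe_ennreal_iff] at h2
  · intro h
    exact EReal.sub_le_sub (EReal.coe_ennreal_le_coe_ennreal_iff.2 h) le_rfl

/-! ### Transfer to `G`, variational principle and stability. -/

namespace Setting

variable {X K : Type*} [MeasurableSpace X] (S : Setting X K)

theorem coe_add_mul_G {q lam : ℝ} (hq : 0 ≤ q) (hlam : 0 < lam) (u : L2 K) :
    (q : EReal) + (lam : EReal) * S.G u =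
      ((ENNReal.ofReal q + ENNReal.ofReal lam * S.W u : ℝ≥0∞) : EReal) -
        ((lam * ∑' k, S.offset k : ℝ) : EReal) := by
  rw [G_eq]
  induction h : S.W u with
  | top =>
    rw [ENNReal.mul_top (by simpa using hlam), add_top, EReal.coe_ennreal_top, EReal.top_sub_coe,
      EReal.top_sub_coe, EReal.coe_mul_top_of_pos hlam, EReal.coe_add_top]
  | coe x =>
    have e : ENNReal.ofReal q + ENNReal.ofReal lam * (x : ℝ≥0∞) = ENNReal.ofReal (q + lam * x) := by
      rw [ENNReal.ofReal_add hq (by positivity), ENNReal.ofReal_mul hlam.le,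
        ENNReal.ofReal_coe_nnreal]
    rw [e, EReal.coe_ennreal_ofReal, max_eq_left (by positivity),
      show ((x : ℝ≥0∞) : EReal) = ((x : ℝ) : EReal) from rfl]
    norm_cast
    ring

theorem G_eq_coe {u : L2 K} (hu : S.W u ≠ ⊤) :
    S.G u = (((S.W u).toReal - ∑' k, S.offset k : ℝ) : EReal) := by
  rw [G_eq, EReal.coe_sub]
  generalize S.W u = x at hu
  lift x to NNReal using hu
  rfl

theorem G_eq_top {u : L2 K} (hu : S.W u = ⊤) : S.G u = ⊤ := by
  rw [G_eq, hu, EReal.coe_ennreal_top, EReal.top_sub_coe]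

variable {S}

theorem memLr_of_W_ne_top {u : L2 K} (hu : S.W u ≠ ⊤) : MemLr S.r u :=
  (memLr_iff S.r_pos _).2 (S.lrENorm_ne_top hu)

/-- The strong convexity argument produces the larger constant `r (r - 1)`; this comparison is the
only place where the shape of `M` matters. -/
theorem M_le : S.M ≤ S.r * (S.r - 1) := by
  have h1 := S.one_lt_r
  have h2 : 0 ≤ (2 / 3 : ℝ) ^ (S.r - 1) := by positivity
  have h3 : 0 ≤ S.r * (S.r - 1) := by nlinarith
  have : S.M = 7 / 32 * (1 - (2 / 3 : ℝ) ^ (S.r - 1)) * (S.r * (S.r - 1)) := by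
    unfold M
    ring
  rw [this]
  nlinarith

variable {Q B : L2 K → ℝ} {grad : L2 K → L2 K} {c lam : ℝ}

theorem objective_zero_ne_top : S.objective (fun x => ENNReal.ofReal (Q x)) lam 0 ≠ ⊤ :=
  ENNReal.add_ne_top.2 ⟨ENNReal.ofReal_ne_top,
    ENNReal.mul_ne_top ENNReal.ofReal_ne_top S.W_zero_ne_top⟩

theorem lowerSemicontinuous_ofReal (hQ : IsQuadratic Q grad B c) :
    LowerSemicontinuous fun u => ENNReal.ofReal (Q u) :=
  (ENNReal.continuous_ofReal.comp hQ.continuous).lowerSemicontinuous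

theorem isConvexENNReal_lrENorm_sub (a : L2 K) :
    IsConvexENNReal fun u : L2 K => lrENorm S.r ⇑(u - a) := by
  intro u v t ht0 ht1
  have ht1' : 0 < 1 - t := by linarith
  have e : (⇑(u + t • (v - u) - a) : K → ℝ) = (1 - t) • ⇑(u - a) + t • ⇑(v - a) := by
    ext k
    simp only [lp.coeFn_add, lp.coeFn_smul, lp.coeFn_sub, Pi.add_apply, Pi.smul_apply,
      Pi.sub_apply, smul_eq_mul]
    ring
  simp only [e]
  refine (lrENorm_add_le S.one_lt_r.le _ _).trans_eq ?_
  rw [lrENorm_smul S.r_pos, lrENorm_smul S.r_pos, Real.enorm_of_nonneg ht1'.le,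
    Real.enorm_of_nonneg ht0.le]

/-- A variational principle: near each `ε`-minimizer of `Q + lam W` there is a minimizer of the
functional perturbed by `√ε` times the `ℓ^r` distance. -/
theorem exists_perturbed_minimizer (hQ : IsQuadratic Q grad B c) (hlam : 0 < lam) {e : ℝ}
    (he : 0 ≤ e) {a : L2 K} (ha : S.W a ≠ ⊤)
    (hmin : ∀ w, S.objective (fun x => ENNReal.ofReal (Q x)) lam a ≤
      S.objective (fun x => ENNReal.ofReal (Q x)) lam w + ENNReal.ofReal e) :
    ∃ v, S.W v ≠ ⊤ ∧ lrENorm S.r ⇑(v - a) ≤ ENNReal.ofReal √e ∧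
      ∀ w, S.objective (fun x => ENNReal.ofReal (Q x)) lam v ≤
        S.objective (fun x => ENNReal.ofReal (Q x)) lam w +
          ENNReal.ofReal √e * lrENorm S.r ⇑(w - v) := by
  rcases he.eq_or_lt with rfl | he
  -- For `e = 0` the point `a` is already a minimizer; the argument below cancels `√e` and needs it
  -- positive.
  · exact ⟨a, ha, by simp only [lrENorm_sub_self S.r_pos, zero_le], fun w => by simpa using hmin w⟩
  have hs : 0 < √e := Real.sqrt_pos.2 he
  set A : L2 K → ℝ≥0∞ := fun x => ENNReal.ofReal (Q x) + ENNReal.ofReal √e * lrENorm S.r ⇑(x - a)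
    with hA
  set J := S.objective (fun x => ENNReal.ofReal (Q x)) lam with hJ
  have hobj : ∀ x, S.objective A lam x = J x + ENNReal.ofReal √e * lrENorm S.r ⇑(x - a) := fun x => by
    simp only [hJ, objective, hA]
    ring
  have hAl : LowerSemicontinuous A := by
    have h1 : LowerSemicontinuous fun x : L2 K => lrENorm S.r ⇑(x - a) :=
      (lowerSemicontinuous_lrENorm S.r_pos).comp (continuous_id.sub continuous_const)
    exact (lowerSemicontinuous_ofReal hQ).add
      ((ENNReal.continuous_const_mul ENNReal.ofReal_ne_top).comp_lowerSemicontinuous h1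
        fun _ _ h => mul_le_mul_right h _)
  have hAc : IsConvexENNReal A := by
    intro u v t ht0 ht1
    have h1 := hQ.isConvexENNReal u v t ht0 ht1
    have h2 := isConvexENNReal_lrENorm_sub (S := S) a u v t ht0 ht1
    refine (add_le_add h1 (mul_le_mul_right h2 (ENNReal.ofReal √e))).trans_eq ?_
    simp only [hA]
    ring
  have hJa : J a ≠ ⊤ := ENNReal.add_ne_top.2 ⟨ENNReal.ofReal_ne_top,
    ENNReal.mul_ne_top ENNReal.ofReal_ne_top ha⟩
  have hobja : S.objective A lam a = J a := by
    rw [hobj, lrENorm_sub_self S.r_pos, mul_zero, add_zero]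
  obtain ⟨v, hv⟩ := exists_minimizer hAl hAc hlam (hobja.trans_ne hJa)
  have hva := hv a
  rw [hobja, hobj] at hva
  have hJv : J v ≠ ⊤ := ne_top_of_le_ne_top hJa (le_self_add.trans hva)
  have hdist : lrENorm S.r ⇑(v - a) ≤ ENNReal.ofReal √e := by
    -- Optimality of `v` against `a`, with `a` an `e`-minimizer, gives `√e * ‖v - a‖_r ≤ e = √e *
    -- √e`.
    have h1 := (ENNReal.add_le_add_iff_left hJv).1 (hva.trans (hmin v))
    have h2 : ENNReal.ofReal e = ENNReal.ofReal √e * ENNReal.ofReal √e := by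
      rw [← ENNReal.ofReal_mul hs.le, Real.mul_self_sqrt he.le]
    rw [h2] at h1
    exact (ENNReal.mul_le_mul_iff_right (by simpa using he) ENNReal.ofReal_ne_top).1 h1
  refine ⟨v, W_ne_top_of_objective hlam hJv, hdist, fun w => ?_⟩
  have hw := hv w
  rw [hobj, hobj] at hw
  -- The triangle inequality recentres the penalty from `a` to `v`.
  have htri : lrENorm S.r ⇑(w - a) ≤ lrENorm S.r ⇑(w - v) + lrENorm S.r ⇑(v - a) := by
    have := lrENorm_add_le S.one_lt_r.le ⇑(w - v) ⇑(v - a)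
    rwa [← lp.coeFn_add, sub_add_sub_cancel] at this
  have hfin : ENNReal.ofReal √e * lrENorm S.r ⇑(v - a) ≠ ⊤ :=
    ENNReal.mul_ne_top ENNReal.ofReal_ne_top (ne_top_of_le_ne_top ENNReal.ofReal_ne_top hdist)
  refine (ENNReal.add_le_add_iff_right hfin).1 (hw.trans ?_)
  rw [add_assoc, ← mul_add]
  gcongr

/-- The distance between the minimizer of a regularized quadratic functional and an approximate
stationary point of another one is controlled by the difference of the gradients. -/
theorem stability {Q' B' : L2 K → ℝ} {grad' : L2 K → L2 K} {c' : ℝ}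
    (hQ : IsQuadratic Q grad B c) (hQ' : IsQuadratic Q' grad' B' c') (hlam : 0 < lam) {e : ℝ}
    (he : 0 ≤ e) {u v : L2 K} (hWu : S.W u ≠ ⊤) (hWv : S.W v ≠ ⊤)
    (hu : ∀ w, S.objective (fun x => ENNReal.ofReal (Q x)) lam u ≤
      S.objective (fun x => ENNReal.ofReal (Q x)) lam w)
    (hv : ∀ w, S.objective (fun x => ENNReal.ofReal (Q' x)) lam v ≤
      S.objective (fun x => ENNReal.ofReal (Q' x)) lam w +
        ENNReal.ofReal e * lrENorm S.r ⇑(w - v)) :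
    S.η * S.M * lrNorm S.r ⇑(v - u) /
        (lrNorm S.r u + lrNorm S.r ⇑(v - u)) ^ (2 - S.r) ≤
      1 / lam * (‖grad' u - grad u‖ + e) := by
  have hη := S.η_pos
  have hr2 : 0 ≤ 2 - S.r := by linarith [S.r_le_two]
  have hNu := S.lrENorm_ne_top hWu
  have hNv := S.lrENorm_ne_top hWv
  have hNd : lrENorm S.r ⇑(v - u) ≠ ⊤ := by
    have := lrENorm_add_le S.one_lt_r.le ⇑v ⇑(-u)
    rw [← lp.coeFn_add, lp.coeFn_neg, lrENorm_neg, ← sub_eq_add_neg] at this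
    exact ne_top_of_le_ne_top (ENNReal.add_ne_top.2 ⟨hNv, hNu⟩) this
  set N := lrNorm S.r ⇑(v - u) with hN
  set N₀ := lrNorm S.r ⇑u with hN₀
  have hNe : N = (lrENorm S.r ⇑(v - u)).toReal := lrNorm_eq S.r_pos _
  have hN0e : N₀ = (lrENorm S.r ⇑u).toReal := lrNorm_eq S.r_pos _
  have hN00 : 0 ≤ N₀ := hN0e ▸ ENNReal.toReal_nonneg
  have hNnn : 0 ≤ N := hNe ▸ ENNReal.toReal_nonneg
  -- The case `N = 0` includes `u = v = 0`, where the quotient is `0` whatever its denominator.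
  rcases hNnn.eq_or_lt with h0 | hNpos
  · rw [← h0, mul_zero, zero_div]
    positivity
  -- This choice dominates both `|u|` and `|v|` and has norm at most `N₀ + N`, the base of the
  -- denominator in the conclusion.
  set m : K → ℝ := fun k => |u k| + |(v - u) k| with hm
  have hmu : ∀ k, |u k| ≤ m k := fun k => le_add_of_nonneg_right (abs_nonneg _)
  have hmv : ∀ k, |v k| ≤ m k := fun k => by
    have := abs_add_le (u k) ((v - u) k)
    simpa [hm] using this
  have h1 := first_order hQ (e := 0) hlam le_rfl hmu hmv hWu hWv fun t _ _ => by
    simpa using hu _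
  -- At step `t` from `v` towards `u` the penalty equals `e * t * N`, hence the error rate `e * N`.
  have h2 := first_order hQ' (e := e * N) hlam (by positivity) hmv hmu hWv hWu fun t ht0 _ => by
    refine (hv (v + t • (u - v))).trans_eq ?_
    have e1 : (⇑(v + t • (u - v) - v) : K → ℝ) = t • ⇑(u - v) := by
      rw [add_sub_cancel_left, lp.coeFn_smul]
    have e2 : lrENorm S.r ⇑(u - v) = ENNReal.ofReal N := by
      rw [hNe, ENNReal.ofReal_toReal hNd, lp.coeFn_sub, lp.coeFn_sub, lrENorm_sub_comm]
    rw [e1, lrENorm_smul S.r_pos, Real.enorm_of_nonneg ht0.le, e2,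
      ← ENNReal.ofReal_mul ht0.le, ← ENNReal.ofReal_mul he]
    congr 2
    ring
  obtain ⟨hgap, h1⟩ := h1
  have h2 := h2.2
  rw [S.gap_comm] at h2
  set s := (S.gap m u v).toReal with hs
  have hs0 : 0 ≤ s := ENNReal.toReal_nonneg
  have hsq : N ^ 2 ≤ s * (N₀ + N) ^ (2 - S.r) := by
    have h : lrENorm S.r ⇑(v - u) ^ 2 ≤ _ := S.lrENorm_sub_sq_le_gap hmu hmv
    have hNm : lrENorm S.r m ≤ ENNReal.ofReal (N₀ + N) := by
      rw [ENNReal.ofReal_add hN00 hNnn, hN0e, hNe, ENNReal.ofReal_toReal hNu,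
        ENNReal.ofReal_toReal hNd]
      have := lrENorm_add_le S.one_lt_r.le (fun k => |u k|) (fun k => |(v - u) k|)
      rwa [lrENorm_abs, lrENorm_abs] at this
    have h' := h.trans (mul_le_mul_right (ENNReal.rpow_le_rpow hNm hr2) _)
    rw [← ENNReal.ofReal_toReal hNd, ← hNe, ← ENNReal.ofReal_pow hNnn,
      ← ENNReal.ofReal_toReal hgap, ENNReal.ofReal_rpow_of_nonneg (by positivity) hr2,
      ← ENNReal.ofReal_mul hs0, ENNReal.ofReal_le_ofReal_iff (by positivity)] at h'
    exact h'
  -- Monotonicity replaces `grad' v` by `grad' u`, so both gradients are taken at the deterministic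
  -- point `u`.
  have hinner : inner ℝ (grad u) (v - u) + inner ℝ (grad' v) (u - v) ≤ ‖grad' u - grad u‖ * N := by
    have h3 := hQ'.inner_grad_le u v
    have h4 : inner ℝ (grad u) (v - u) + inner ℝ (grad' u) (u - v) =
        inner ℝ (grad' u - grad u) (u - v) := by
      rw [inner_sub_left, ← neg_sub u v, inner_neg_right]
      ring
    have h5 := real_inner_le_norm (grad' u - grad u) (u - v)
    have h6 : ‖u - v‖ ≤ N := by
      have := ENNReal.toReal_mono hNd (enorm_le_lrENorm S.r_pos S.r_le_two (v - u))
      rwa [toReal_enorm, ← hNe, norm_sub_rev] at this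
    nlinarith [mul_le_mul_of_nonneg_left h6 (norm_nonneg (grad' u - grad u))]
  -- In the sum of the two first-order inequalities the `W` terms cancel and the gap occurs twice,
  -- which turns `modulus` into `η r (r - 1)`.
  have hmain : lam * (S.η * (S.r * (S.r - 1))) * s ≤ (‖grad' u - grad u‖ + e) * N := by
    have : S.modulus * 2 = S.η * (S.r * (S.r - 1)) := by
      unfold modulus
      ring
    rw [← this]
    linarith
  set D := (N₀ + N) ^ (2 - S.r) with hD
  have hD0 : 0 < D := Real.rpow_pos_of_pos (by linarith) _
  have hr0 : 0 ≤ S.r * (S.r - 1) := by nlinarith [S.one_lt_r]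
  rw [div_le_iff₀ hD0, one_div, mul_assoc lam⁻¹, le_inv_mul_iff₀ hlam]
  refine le_of_mul_le_mul_right ?_ hNpos
  calc lam * (S.η * S.M * N) * N = S.M * (lam * S.η * N ^ 2) := by ring
    _ ≤ S.r * (S.r - 1) * (lam * S.η * N ^ 2) := by
      gcongr
      exact M_le
    _ ≤ S.r * (S.r - 1) * (lam * S.η * (s * D)) := by gcongr
    _ = lam * (S.η * (S.r * (S.r - 1))) * s * D := by ring
    _ ≤ (‖grad' u - grad u‖ + e) * N * D := by gcongr
    _ = (‖grad' u - grad u‖ + e) * D * N := by ring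

/-- This is `first_order` with zero error, the nonnegative gap discarded and the inequality divided
by `lam`. -/
theorem neg_grad_mem_smul_subdifferential (hQ : IsQuadratic Q grad B c) (hlam : 0 < lam)
    {u : L2 K} (hWu : S.W u ≠ ⊤)
    (hu : ∀ w, S.objective (fun x => ENNReal.ofReal (Q x)) lam u ≤
      S.objective (fun x => ENNReal.ofReal (Q x)) lam w) :
    -grad u ∈ lam • subdifferential S.G u := by
  refine Set.mem_smul_set.2 ⟨lam⁻¹ • -grad u, fun v => ?_, smul_inv_smul₀ hlam.ne' _⟩
  by_cases hWv : S.W v = ⊤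
  · rw [S.G_eq_top hWv]
    exact le_top
  have h := (first_order hQ (e := 0) (m := fun k => |u k| + |v k|) hlam le_rfl
    (fun k => le_add_of_nonneg_right (abs_nonneg _))
    (fun k => le_add_of_nonneg_left (abs_nonneg _)) hWu hWv fun t _ _ => by simpa using hu _).2
  have h0 : 0 ≤ lam * S.modulus * (S.gap (fun k => |u k| + |v k|) u v).toReal :=
    mul_nonneg (mul_pos hlam S.modulus_pos).le ENNReal.toReal_nonneg
  rw [S.G_eq_coe hWu, S.G_eq_coe hWv, ← EReal.coe_add, EReal.coe_le_coe_iff, inner_smul_right,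
    inner_neg_right, real_inner_comm]
  have h1 : 0 ≤ lam * ((S.W v).toReal - (S.W u).toReal + lam⁻¹ * inner ℝ (grad u) (v - u)) := by
    rw [mul_add, mul_inv_cancel_left₀ hlam.ne']
    linarith
  have h2 := nonneg_of_mul_nonneg_right h1 hlam
  linarith

end Setting
end RegLearning
end

/-! ### Assembly of the theorem. -/

theorem mainTheorem4 {X K : Type*} [MeasurableSpace X] [Countable K]
    (S : RegLearning.Setting X K)
    (ε : ℝ → ℝ) (hε : ∀ l : ℝ, 0 < l → ε l ∈ Set.Icc (0 : ℝ) 1)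
    (hε0 : Tendsto ε (𝓝[>] 0) (𝓝 0))
    (lam : ℝ) (hlam : 0 < lam) :
    ∃ uL : RegLearning.L2 K,
      -- `uL` is the unique minimizer of `F + lam G`, and it is `r`-summable
      (∀ v, S.regRisk lam uL ≤ S.regRisk lam v) ∧
      (∀ w, (∀ v, S.regRisk lam w ≤ S.regRisk lam v) → w = uL) ∧
      RegLearning.MemLr S.r uL ∧
      -- part (i)
      (∀ z, ‖S.Psi uL z‖ ≤ 2 * S.κ * (S.κ * ‖uL‖ + S.b)) ∧
      MemLp (S.Psi uL) 2 S.P ∧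
      eLpNorm (S.Psi uL) 2 S.P ≤ ENNReal.ofReal (2 * S.κ * √(S.risk (S.f uL))) ∧
      -(∫ z, S.Psi uL z ∂S.P) ∈ lam • RegLearning.subdifferential S.G uL ∧
      -- part (ii)
      (∀ (n : ℕ), 0 < n → ∀ (z : Fin n → X × S.Y),
        ∀ uhat ∈ RegLearning.argminEps (S.empRisk lam z) (ε lam),
          RegLearning.MemLr S.r uhat ∧
          ∃ v : RegLearning.L2 K,
            RegLearning.MemLr S.r v ∧
            RegLearning.lrNorm S.r (v - uhat) ≤ √(ε lam) ∧
            S.η * S.M * RegLearning.lrNorm S.r (v - uL) /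
                (RegLearning.lrNorm S.r uL + RegLearning.lrNorm S.r (v - uL)) ^ (2 - S.r) ≤
              1 / lam * (‖(1 / (n : ℝ)) • (∑ i, S.Psi uL (z i)) - (∫ w, S.Psi uL w ∂S.P)‖
                + √(ε lam))) := by
  have hF := S.isQuadratic_F
  have hreg : ∀ u v, S.regRisk lam u ≤ S.regRisk lam v ↔
      S.objective (fun x => ENNReal.ofReal (S.F x)) lam u ≤
        S.objective (fun x => ENNReal.ofReal (S.F x)) lam v := fun u v => by
    have h := RegLearning.ereal_coe_sub_le_iff (a := S.objective (fun x => ENNReal.ofReal (S.F x)) lam u)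
      (b := S.objective (fun x => ENNReal.ofReal (S.F x)) lam v)
      (c := lam * ∑' k, S.offset k) (e := 0) le_rfl
    rw [EReal.coe_zero, add_zero, ENNReal.ofReal_zero, add_zero] at h
    rw [RegLearning.Setting.regRisk, RegLearning.Setting.regRisk, S.coe_add_mul_G (hF.nonneg _) hlam,
      S.coe_add_mul_G (hF.nonneg _) hlam]
    exact h
  simp only [hreg]
  obtain ⟨u, hu⟩ := RegLearning.Setting.exists_minimizer (S := S) (RegLearning.Setting.lowerSemicontinuous_ofReal hF)
    hF.isConvexENNReal hlam RegLearning.Setting.objective_zero_ne_top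
  have hWu : S.W u ≠ ⊤ := RegLearning.Setting.W_ne_top_of_objective hlam
    (ne_top_of_le_ne_top RegLearning.Setting.objective_zero_ne_top (hu 0))
  refine ⟨u, hu, fun w hw => RegLearning.Setting.minimizer_unique hF.isConvexENNReal hlam
    RegLearning.Setting.objective_zero_ne_top hw hu, RegLearning.Setting.memLr_of_W_ne_top hWu, S.norm_Psi_le u,
    S.memLp_Psi u 2, S.eLpNorm_Psi_le u,
    RegLearning.Setting.neg_grad_mem_smul_subdifferential hF hlam hWu hu, fun n hn z a ha => ?_⟩
  have hE := S.isQuadratic_empirical hn z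
  have he := (hε lam hlam).1
  have hmin : ∀ w, S.objective (fun x => ENNReal.ofReal
      (1 / (n : ℝ) * ∑ i, |S.f x (z i).1 - ((z i).2 : ℝ)| ^ 2)) lam a ≤
      S.objective (fun x => ENNReal.ofReal
      (1 / (n : ℝ) * ∑ i, |S.f x (z i).1 - ((z i).2 : ℝ)| ^ 2)) lam w +
        ENNReal.ofReal (ε lam) := fun w => by
    have h1 : S.empRisk lam z a ≤ S.empRisk lam z w + (ε lam : EReal) :=
      le_trans ha (add_le_add_left (iInf_le _ w) _)
    rw [RegLearning.Setting.empRisk, RegLearning.Setting.empRisk, S.coe_add_mul_G (hE.nonneg _) hlam,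
      S.coe_add_mul_G (hE.nonneg _) hlam, RegLearning.ereal_coe_sub_le_iff he] at h1
    exact h1
  have hWa : S.W a ≠ ⊤ := RegLearning.Setting.W_ne_top_of_objective hlam
    (ne_top_of_le_ne_top (ENNReal.add_ne_top.2 ⟨RegLearning.Setting.objective_zero_ne_top,
      ENNReal.ofReal_ne_top⟩) (hmin 0))
  obtain ⟨v, hWv, hdist, hv⟩ := RegLearning.Setting.exists_perturbed_minimizer hE hlam he hWa hmin
  have hstab := RegLearning.Setting.stability hF hE hlam (Real.sqrt_nonneg _) hWu hWv hu hv
  refine ⟨RegLearning.Setting.memLr_of_W_ne_top hWa, v, RegLearning.Setting.memLr_of_W_ne_top hWv, ?_, ?_⟩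
  · rw [RegLearning.lrNorm_eq S.r_pos]
    exact ENNReal.toReal_le_of_le_ofReal (Real.sqrt_nonneg _) hdist
  · exact hstab
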